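/- Let $\Delta$ be a finite simplicial complex in $\mathbb{R}^2$ such that every simplex of $\Delta$ is a face of a triangle of $\Delta$ and such that its support $|\Delta|\subset\mathbb{R}^2$ is homotopy equivalent to a disk. Let $r,k\ge 0$ be integers and let $C^r_k(\Delta)$ be the real vector space of all functions of class $C^r$ on $|\Delta|$ whose restriction to each simplex of $\Delta$ is a polynomial of total degree at most $k$. Let $\partial\Delta$ be the complex consisting of all edges of $\Delta$ that lie on exactly one triangle of $\Delta$, together with their endpoints; the edges and vertices of $\Delta$ not in $\partial\Delta$ are called interior. Let $f_1^0$ be the number of interior edges and let $\gamma_1,\dots,\gamma_{f_0^0}$ be the interior vertices. For each $i$ let $t_i$ be the number of different slopes of the edges of $\Delta$ containing $\gamma_i$ (so $t_i\ge 2$), and put \[ \Omega_i=\left\lfloor\frac{t_i\,r}{t_i-1}\right\rfloor+1,\qquad a_i=t_i(r+1)+(1-t_i)\,\Omega_i,\qquad b_i=t_i-1-a_i . \] Then $C^r_k(\Delta)$ is finite dimensional and, with the convention $\binom{n}{2}=0$ for every integer $n<2$, \[ \dim C_k^r(\Delta)\ \ge\ \binom{k+2}{2}+f_1^0\binom{k+2-(r+1)}{2}-\sum_{i=1}^{f_0^0}\left[t_i\binom{k+2-(r+1)}{2}-b_i\binom{k+2-\Omega_i}{2}-a_i\binom{k+2-(\Omega_i+1)}{2}\right].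 \] -/

import Mathlib

open Geometry

noncomputable section

namespace Spline

/-- The Euclidean plane. -/
abbrev Plane : Type := EuclideanSpace ℝ (Fin 2)

/-- Every simplex is a face of a triangle of the complex. -/
def IsPure (Δ : SimplicialComplex ℝ Plane) : Prop :=
  ∀ s ∈ Δ.faces, ∃ σ ∈ Δ.faces, σ.card = 3 ∧ s ⊆ σ

/-- The simplices of the boundary complex: the edges lying on exactly one triangle,
together with all their faces. -/
def boundaryFaces (Δ : SimplicialComplex ℝ Plane) : Set (Finset Plane) :=
  {s | s ∈ Δ.faces ∧ ∃ τ ∈ Δ.faces, τ.card = 2 ∧ s ⊆ τ ∧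
    ∃! σ : Finset Plane, σ ∈ Δ.faces ∧ σ.card = 3 ∧ τ ⊆ σ}

/-- The interior edges. -/
def interiorEdges (Δ : SimplicialComplex ℝ Plane) : Set (Finset Plane) :=
  {τ | τ ∈ Δ.faces ∧ τ.card = 2 ∧ τ ∉ boundaryFaces Δ}

/-- The interior vertices, as points of the plane. -/
def interiorVertices (Δ : SimplicialComplex ℝ Plane) : Set Plane :=
  {v | {v} ∈ Δ.faces ∧ {v} ∉ boundaryFaces Δ}

open Classical in
/-- The slopes (directions of lines through the origin) of the edges containing `v`. -/
def edgeSlopes (Δ : SimplicialComplex ℝ Plane) (v : Plane) : Set (Submodule ℝ Plane) :=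
  {L | ∃ w : Plane, w ≠ v ∧ ({v, w} : Finset Plane) ∈ Δ.faces ∧ L = Submodule.span ℝ {w - v}}

/-- `t`: the number of different slopes of the edges containing `v`. -/
def slopeCount (Δ : SimplicialComplex ℝ Plane) (v : Plane) : ℕ :=
  (edgeSlopes Δ v).ncard

/-- `Ω = ⌊t r / (t - 1)⌋ + 1` (used for `t ≥ 2`). -/
def Omega (t r : ℕ) : ℕ := t * r / (t - 1) + 1

/-- `a = t (r + 1) + (1 - t) Ω`. -/
def aMult (t r : ℕ) : ℤ := (t : ℤ) * ((r : ℤ) + 1) + (1 - (t : ℤ)) * (Omega t r : ℤ)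

/-- `b = t - 1 - a`. -/
def bMult (t r : ℕ) : ℤ := (t : ℤ) - 1 - aMult t r

/-- The vector space of functions on `|Δ|` that are of class `C^r` and whose restriction to every
simplex is a polynomial function of total degree at most `k`.  (`ContDiffOn ℝ r F Δ.space` only
depends on the values of `F` on `Δ.space`.) -/
def splineSpace (Δ : SimplicialComplex ℝ Plane) (r k : ℕ) : Submodule ℝ (Δ.space → ℝ) where
  carrier := {f |
    (∃ F : Plane → ℝ, ContDiffOn ℝ (r : WithTop ℕ∞) F Δ.space ∧ ∀ x : Δ.space, f x = F x) ∧
    ∀ s ∈ Δ.faces, ∃ p : MvPolynomial (Fin 2) ℝ, p.totalDegree ≤ k ∧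
      ∀ x : Δ.space, (x : Plane) ∈ convexHull ℝ (s : Set Plane) →
        f x = MvPolynomial.eval (fun i => (x : Plane) i) p}
  add_mem' := by
    rintro f g ⟨⟨F, hF, hfF⟩, hf⟩ ⟨⟨G, hG, hgG⟩, hg⟩
    refine ⟨⟨F + G, hF.add hG, fun x => by simp [hfF, hgG]⟩, fun s hs => ?_⟩
    obtain ⟨p, hp, hpf⟩ := hf s hs
    obtain ⟨q, hq, hqg⟩ := hg s hs
    exact ⟨p + q, (MvPolynomial.totalDegree_add p q).trans (max_le hp hq),
      fun x hx => by simp [hpf x hx, hqg x hx]⟩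
  zero_mem' :=
    ⟨⟨0, contDiffOn_const, fun _ => rfl⟩, fun _ _ => ⟨0, by simp, fun _ _ => by simp⟩⟩
  smul_mem' := by
    rintro c f ⟨⟨F, hF, hfF⟩, hf⟩
    refine ⟨⟨c • F, hF.const_smul c, fun x => by simp [hfF]⟩, fun s hs => ?_⟩
    obtain ⟨p, hp, hpf⟩ := hf s hs
    exact ⟨c • p, (MvPolynomial.totalDegree_smul_le c p).trans hp,
      fun x hx => by simp [hpf x hx, MvPolynomial.smul_eval]⟩

end Spline

end

/-! A spline is a choice of polynomials on the triangles that fit together, and the bound comes from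
counting unknowns and independent equations in a linear system that suffices for fitting. Let `P` be
the polynomials of degree at most `k` and `Q` the cofactors of degree less than `k - r`. The
unknowns are a polynomial per triangle, a cofactor per interior edge and an auxiliary polynomial per
boundary vertex. Across an interior edge the two polynomials must differ by the cofactor times the
`(r+1)`-st power of the edge's line. At a boundary edge, oriented with the complex on its left, the
polynomial of the adjacent triangle must equal the auxiliary one at the initial vertex.

Solutions inject into the splines. Jets of order `r` agree along interior edges, hence throughout
the star of an interior vertex. The star of a boundary vertex may split into several fans meeting
only at that vertex, where no edge condition compares them; each fan has an outgoing boundary edge,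
and there the auxiliary polynomial links them (`jetEq_of_vertex`). Polynomials with compatible jets
then form a Whitney-free Taylor series on a finite union of closed triangles, so they glue to a
`C^r` function (`exists_contDiffOn_glue`).

The equations are dependent. Around an interior vertex `v` the differences across edges sum to zero,
so the signed sum of the left sides lies in the space `J v` spanned by the multiples of the
`(r+1)`-st powers of the lines at `v`. Since the signed sum map onto the interior vertices is
surjective (`divergence_surjective`), the rank drops by at least the sum of `dim P - dim (J v)`
(`finrank_ker_gluing_ge`). What remains is the Euler characteristic times `dim P`, plus the
cofactors, minus the sum of `dim (J v)`.

Two estimates finish the count. The Euler characteristic is at least one (`euler_char_ge`), because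
contractibility kills the first cohomology: an integral cocycle defines a circle-valued map, whose
lift to the line is a potential. Further, `dim (J v)` is bounded by splitting degrees, centred at
`v`, at `Omega`: below it one counts generators, above it all monomials
(`finrank_sup_lineMul_add_le`, `le_vertex_bound`). -/

open Geometry Topology

noncomputable section

namespace Spline

open scoped Classical

/-! ### Planar geometry of triangles and their tangent cones. -/

section Geometry

/-- The determinant of two plane vectors. -/
def det2 (a b : Plane) : ℝ := a 0 * b 1 - a 1 * b 0

/-- Twice the signed area of the triangle `v w u`. -/
def orient (v w u : Plane) : ℝ := det2 (w - v) (u - v)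

lemma det2_add_left (a b c : Plane) : det2 (a + b) c = det2 a c + det2 b c := by
  simp [det2]; ring

lemma det2_add_right (a b c : Plane) : det2 a (b + c) = det2 a b + det2 a c := by
  simp [det2]; ring

lemma det2_smul_left (t : ℝ) (a b : Plane) : det2 (t • a) b = t * det2 a b := by
  simp [det2]; ring

lemma det2_smul_right (t : ℝ) (a b : Plane) : det2 a (t • b) = t * det2 a b := by
  simp [det2]; ring

lemma det2_self (a : Plane) : det2 a a = 0 := by
  simp [det2]; ring

lemma det2_swap (a b : Plane) : det2 b a = -det2 a b := by
  simp [det2]; ring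

lemma det2_zero_right (a : Plane) : det2 a 0 = 0 := by simp [det2]

lemma continuous_det2_right (a : Plane) : Continuous fun d => det2 a d := by
  unfold det2; fun_prop

lemma continuous_det2_left (a : Plane) : Continuous fun d => det2 d a := by
  unfold det2; fun_prop

lemma eq_smul_add_smul_of_det2_ne_zero {A B : Plane} (h : det2 A B ≠ 0) (d : Plane) :
    d = (det2 d B / det2 A B) • A + (det2 A d / det2 A B) • B := by
  ext i
  have : ∀ i : Fin 2, d i = (det2 d B / det2 A B) * A i + (det2 A d / det2 A B) * B i := by
    intro i
    field_simp
    fin_cases i <;> simp [det2] <;> ring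
  simpa using this i

lemma exists_eq_smul_of_det2_eq_zero {A d : Plane} (hA : A ≠ 0) (h : det2 A d = 0) :
    ∃ a : ℝ, d = a • A := by
  have h' : A 0 * d 1 = A 1 * d 0 := by simpa [det2, sub_eq_zero] using h
  by_cases h0 : A 0 = 0
  · have h1 : A 1 ≠ 0 := by
      intro h1
      apply hA
      ext i
      fin_cases i <;> simp [h0, h1]
    refine ⟨d 1 / A 1, ?_⟩
    ext i
    fin_cases i
    · have : d 0 = 0 := by
        rw [h0, zero_mul] at h'
        simpa [h1] using h'.symm
      simp [h0, this]
    · simp [h1]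
  · refine ⟨d 0 / A 0, ?_⟩
    ext i
    fin_cases i
    · simp [h0]
    · simp only [PiLp.smul_apply, smul_eq_mul]
      field_simp
      simp
      linarith

lemma orient_swap (v w u : Plane) : orient v u w = -orient v w u := det2_swap _ _

lemma orient_swap_left (v w u : Plane) : orient w v u = -orient v w u := by
  simp [orient, det2]; ring

lemma orient_self (v w : Plane) : orient v w w = 0 := det2_self _

/-- The points `v`, `w`, `u` are the vertices of a triangle of the complex. -/
structure IsTri (Δ : SimplicialComplex ℝ Plane) (v w u : Plane) : Prop where
  mem : ({v, w, u} : Finset Plane) ∈ Δ.faces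
  orient_ne : orient v w u ≠ 0

variable {Δ : SimplicialComplex ℝ Plane} {v w u : Plane}

namespace IsTri

lemma ne₁₂ (h : IsTri Δ v w u) : v ≠ w := by
  rintro rfl; exact h.orient_ne (by simp [orient, det2])

lemma ne₁₃ (h : IsTri Δ v w u) : v ≠ u := by
  rintro rfl; exact h.orient_ne (by simp [orient, det2])

lemma ne₂₃ (h : IsTri Δ v w u) : w ≠ u := by
  rintro rfl; exact h.orient_ne (orient_self _ _)

lemma swap (h : IsTri Δ v w u) : IsTri Δ v u w := by
  refine ⟨?_, ?_⟩
  · rw [Finset.pair_comm]; exact h.mem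
  · rw [orient_swap]; exact neg_ne_zero.2 h.orient_ne

lemma swap_left (h : IsTri Δ v w u) : IsTri Δ w v u := by
  refine ⟨?_, ?_⟩
  · rw [Finset.insert_comm]; exact h.mem
  · rw [orient_swap_left]; exact neg_ne_zero.2 h.orient_ne

lemma card (h : IsTri Δ v w u) : ({v, w, u} : Finset Plane).card = 3 :=
  Finset.card_eq_three.2 ⟨v, w, u, h.ne₁₂, h.ne₁₃, h.ne₂₃, rfl⟩

end IsTri

lemma orient_ne_zero_of_mem_faces (h : ({v, w, u} : Finset Plane) ∈ Δ.faces)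
    (hvw : v ≠ w) (hvu : v ≠ u) (hwu : w ≠ u) : orient v w u ≠ 0 := by
  intro h0
  have hind := Δ.indep h
  obtain ⟨a, ha⟩ := exists_eq_smul_of_det2_eq_zero (sub_ne_zero.2 hvw.symm) h0
  have hcol : Collinear ℝ (({v, w, u} : Finset Plane) : Set Plane) := by
    rw [collinear_iff_of_mem (p₀ := v) (by simp)]
    refine ⟨w - v, ?_⟩
    intro p hp
    simp only [Finset.coe_insert, Finset.coe_singleton, Set.mem_insert_iff,
      Set.mem_singleton_iff] at hp
    rcases hp with rfl | rfl | rfl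
    · exact ⟨0, by simp⟩
    · exact ⟨1, by simp⟩
    · exact ⟨a, by rw [← ha]; simp⟩
  have hc : ({v, w, u} : Finset Plane).card = 3 :=
    Finset.card_eq_three.2 ⟨v, w, u, hvw, hvu, hwu, rfl⟩
  have h3 : AffineIndependent ℝ ![v, w, u] := by
    let e : Fin 3 ↪ ({v, w, u} : Finset Plane) :=
      ⟨fun i => ⟨![v, w, u] i, by fin_cases i <;> simp⟩, by
        intro i j hij
        simp only [Subtype.mk.injEq] at hij
        fin_cases i <;> fin_cases j <;> simp_all⟩
    have he : (Subtype.val ∘ e) = ![v, w, u] := rfl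
    have := hind.comp_embedding e
    rwa [he] at this
  rw [affineIndependent_iff_not_collinear_set] at h3
  exact h3 (by simpa using hcol)

lemma isTri_of_card_eq_three (h : ({v, w, u} : Finset Plane) ∈ Δ.faces)
    (hc : ({v, w, u} : Finset Plane).card = 3) : IsTri Δ v w u := by
  have hvw : v ≠ w := by
    rintro rfl
    have := Finset.card_le_two (a := v) (b := u)
    simp at hc this; omega
  have hvu : v ≠ u := by
    rintro rfl
    have := Finset.card_le_two (a := v) (b := w)
    rw [Finset.pair_comm, ] at hc
    simp at hc this; omega
  have hwu : w ≠ u := by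
    rintro rfl
    have := Finset.card_le_two (a := v) (b := w)
    simp at hc this; omega
  exact ⟨h, orient_ne_zero_of_mem_faces h hvw hvu hwu⟩

lemma exists_isTri_of_mem {s : Finset Plane} (hs : s ∈ Δ.faces) (hc : s.card = 3) (hv : v ∈ s) :
    ∃ w u, s = {v, w, u} ∧ IsTri Δ v w u := by
  have h2 : (s.erase v).card = 2 := by rw [Finset.card_erase_of_mem hv, hc]
  obtain ⟨w, u, -, he⟩ := Finset.card_eq_two.1 h2
  have hs' : s = {v, w, u} := by rw [← Finset.insert_erase hv, he]
  subst hs'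
  exact ⟨w, u, rfl, isTri_of_card_eq_three hs hc⟩

lemma exists_isTri_of_mem_of_mem {s : Finset Plane} (hs : s ∈ Δ.faces) (hc : s.card = 3)
    (hv : v ∈ s) (hw : w ∈ s) (hvw : v ≠ w) : ∃ u, s = {v, w, u} ∧ IsTri Δ v w u := by
  obtain ⟨a, b, rfl, hT⟩ := exists_isTri_of_mem hs hc hv
  simp only [Finset.mem_insert, Finset.mem_singleton] at hw
  rcases hw with rfl | rfl | rfl
  · exact absurd rfl hvw
  · exact ⟨b, rfl, hT⟩
  · exact ⟨a, by rw [Finset.pair_comm], hT.swap⟩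

lemma mem_convexHull_triple {x : Plane} :
    x ∈ convexHull ℝ (({v, w, u} : Finset Plane) : Set Plane) ↔
      ∃ a b : ℝ, 0 ≤ a ∧ 0 ≤ b ∧ a + b ≤ 1 ∧ x = v + (a • (w - v) + b • (u - v)) := by
  rw [Finset.coe_insert, Finset.coe_insert, Finset.coe_singleton,
    convexHull_insert (by simp), convexHull_pair]
  simp only [convexJoin_singleton_left, Set.mem_iUnion, segment_eq_image', Set.mem_image,
    Set.mem_Icc, exists_prop]
  constructor
  · rintro ⟨_, ⟨t, ⟨ht0, ht1⟩, rfl⟩, s, ⟨hs0, hs1⟩, rfl⟩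
    refine ⟨s * (1 - t), s * t, by nlinarith, by positivity, by nlinarith, ?_⟩
    ext i; simp; ring
  · rintro ⟨a, b, ha, hb, hab, rfl⟩
    by_cases h : a + b = 0
    · have ha' : a = 0 := by linarith
      have hb' : b = 0 := by linarith
      subst ha'; subst hb'
      exact ⟨_, ⟨0, ⟨le_rfl, zero_le_one⟩, rfl⟩, 0, ⟨le_rfl, zero_le_one⟩, by simp⟩
    · refine ⟨_, ⟨b / (a + b), ⟨by positivity, ?_⟩, rfl⟩, a + b, ⟨by positivity, hab⟩, ?_⟩
      · rw [div_le_one (by positivity)]; linarith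
      · ext i
        simp
        field_simp
        ring

lemma det2_eq_zero_of_mem_convexHull_pair {x : Plane}
    (hx : x ∈ convexHull ℝ ({v, w} : Set Plane)) : det2 (w - v) (x - v) = 0 := by
  rw [convexHull_pair, segment_eq_image'] at hx
  obtain ⟨t, -, rfl⟩ := hx
  rw [add_sub_cancel_left, det2_smul_right, det2_self, mul_zero]

lemma mem_convexHull_inter {s t : Finset Plane} (hs : s ∈ Δ.faces) (ht : t ∈ Δ.faces) {x : Plane}
    (hxs : x ∈ convexHull ℝ (s : Set Plane)) (hxt : x ∈ convexHull ℝ (t : Set Plane)) :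
    x ∈ convexHull ℝ ((s ∩ t : Finset Plane) : Set Plane) := by
  rw [Finset.coe_inter]
  exact Δ.inter_subset_convexHull hs ht ⟨hxs, hxt⟩

/-- Two triangles sharing an edge lie on opposite sides of it. -/
lemma orient_mul_orient_neg {u' : Plane} (h : IsTri Δ v w u) (h' : IsTri Δ v w u') (hne : u ≠ u') :
    orient v w u * orient v w u' < 0 := by
  by_contra hcon
  have hpos : 0 < orient v w u * orient v w u' :=
    lt_of_le_of_ne (not_lt.1 hcon) (mul_ne_zero h.orient_ne h'.orient_ne).symm
  set A := w - v with hA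
  set B := u - v with hB
  set B' := u' - v with hB'
  have hAB : det2 A B ≠ 0 := h.orient_ne
  have hAB' : det2 A B' ≠ 0 := h'.orient_ne
  set α := det2 B' B / det2 A B with hα
  set β := det2 A B' / det2 A B with hβ
  have hdec : B' = α • A + β • B := eq_smul_add_smul_of_det2_ne_zero hAB B'
  have hβpos : 0 < β := by
    have : β = (orient v w u * orient v w u') / (det2 A B) ^ 2 := by
      rw [hβ]; simp only [orient, ← hA, ← hB, ← hB']; field_simp
    rw [this]; positivity
  -- Start at the midpoint of the edge and move by `ε` towards `u'`. The coordinates in the first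
  -- triangle are `1/2 + εα` and `εβ`; this `ε` keeps them admissible, so the two triangles share a
  -- point off their common edge.
  set ε : ℝ := 1 / (4 * (1 + |α| + β)) with hε
  have hden : 0 < 1 + |α| + β := by positivity
  have hεpos : 0 < ε := by positivity
  have hε1 : ε * (1 + |α| + β) = 1 / 4 := by rw [hε]; field_simp
  have e1 : ε ≤ 1 / 4 := by nlinarith [abs_nonneg α]
  have e2 : ε * |α| ≤ 1 / 4 := by nlinarith [abs_nonneg α]
  have e3 : ε * α ≤ ε * |α| := mul_le_mul_of_nonneg_left (le_abs_self α) hεpos.le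
  have e4 : -(ε * |α|) ≤ ε * α := by nlinarith [neg_abs_le α]
  have e5 : ε * |α| + ε * β ≤ 1 / 4 := by nlinarith
  have hx' : v + ((1 / 2 : ℝ) • A + ε • B') ∈
      convexHull ℝ (({v, w, u'} : Finset Plane) : Set Plane) :=
    mem_convexHull_triple.2 ⟨1 / 2, ε, by norm_num, hεpos.le, by linarith, rfl⟩
  have hx : v + ((1 / 2 : ℝ) • A + ε • B') ∈
      convexHull ℝ (({v, w, u} : Finset Plane) : Set Plane) := by
    refine mem_convexHull_triple.2 ⟨1 / 2 + ε * α, ε * β, by linarith, by positivity,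
      by linarith, ?_⟩
    rw [hdec]
    module
  have hmem := mem_convexHull_inter h.mem h'.mem hx hx'
  have hsub : (({v, w, u} ∩ {v, w, u'} : Finset Plane) : Set Plane) ⊆ {v, w} := by
    intro y hy
    have := h.ne₂₃
    have := h.ne₁₃
    simp only [Finset.coe_inter, Finset.coe_insert, Finset.coe_singleton, Set.mem_inter_iff,
      Set.mem_insert_iff, Set.mem_singleton_iff] at hy ⊢
    grind
  have h0 := det2_eq_zero_of_mem_convexHull_pair (convexHull_mono hsub hmem)
  rw [add_sub_cancel_left, det2_add_right, det2_smul_right, det2_smul_right, det2_self] at h0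
  have : ε * det2 A B' = 0 := by simpa using h0
  exact (mul_ne_zero hεpos.ne' hAB') this

/-- The tangent cone at `v` of the simplex `s`. -/
def cone (v : Plane) (s : Finset Plane) : Set Plane :=
  {d | ∃ ε : ℝ, 0 < ε ∧ v + ε • d ∈ convexHull ℝ (s : Set Plane)}

lemma mem_cone_iff (h : IsTri Δ v w u) {d : Plane} :
    d ∈ cone v {v, w, u} ↔ 0 ≤ det2 d (u - v) * orient v w u ∧
      0 ≤ det2 (w - v) d * orient v w u := by
  have hne := h.orient_ne
  have hsq : 0 < orient v w u * orient v w u := mul_self_pos.2 hne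
  constructor
  · rintro ⟨ε, hε, hx⟩
    obtain ⟨a, b, ha, hb, -, he⟩ := mem_convexHull_triple.1 hx
    have he' : ε • d = a • (w - v) + b • (u - v) := add_left_cancel he
    have hd : d = (ε⁻¹ * a) • (w - v) + (ε⁻¹ * b) • (u - v) := by
      rw [mul_smul, mul_smul, ← smul_add, ← he', smul_smul, inv_mul_cancel₀ hε.ne', one_smul]
    rw [hd, det2_add_left, det2_add_right, det2_smul_left, det2_smul_right, det2_smul_left,
      det2_smul_right, det2_self, det2_self, mul_zero, mul_zero, add_zero, zero_add]
    change 0 ≤ ε⁻¹ * a * orient v w u * orient v w u ∧ 0 ≤ ε⁻¹ * b * orient v w u * orient v w u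
    rw [mul_assoc, mul_assoc (ε⁻¹ * b)]
    constructor <;> positivity
  · rintro ⟨h1, h2⟩
    set a := det2 d (u - v) / orient v w u with ha
    set b := det2 (w - v) d / orient v w u with hb
    have hd : d = a • (w - v) + b • (u - v) := eq_smul_add_smul_of_det2_ne_zero hne d
    have ha0 : 0 ≤ a := by
      have : a = det2 d (u - v) * orient v w u / (orient v w u * orient v w u) := by
        rw [ha]; field_simp
      rw [this]; positivity
    have hb0 : 0 ≤ b := by
      have : b = det2 (w - v) d * orient v w u / (orient v w u * orient v w u) := by
        rw [hb]; field_simp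
      rw [this]; positivity
    refine ⟨1 / (1 + a + b), by positivity, mem_convexHull_triple.2
      ⟨1 / (1 + a + b) * a, 1 / (1 + a + b) * b, by positivity, by positivity, ?_, ?_⟩⟩
    · field_simp; linarith
    · conv_lhs => rw [hd]
      module

lemma isClosed_cone (h : IsTri Δ v w u) : IsClosed (cone v {v, w, u}) := by
  have : cone v {v, w, u} = {d | 0 ≤ det2 d (u - v) * orient v w u} ∩
      {d | 0 ≤ det2 (w - v) d * orient v w u} := by
    ext d; exact mem_cone_iff h
  rw [this]
  exact (isClosed_le continuous_const ((continuous_det2_left _).mul continuous_const)).inter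
    (isClosed_le continuous_const ((continuous_det2_right _).mul continuous_const))

/-- In a neighbourhood of an edge direction the two triangles at the edge cover everything. -/
lemma cone_union_mem_nhds {u' : Plane} (h : IsTri Δ v w u) (h' : IsTri Δ v w u') (hne : u ≠ u')
    {t : ℝ} (ht : 0 < t) :
    cone v {v, w, u} ∪ cone v {v, w, u'} ∈ 𝓝 (t • (w - v)) := by
  have hneg := orient_mul_orient_neg h h' hne
  have h1 : ∀ᶠ d in 𝓝 (t • (w - v)), 0 < det2 d (u - v) * orient v w u := by
    refine (((continuous_det2_left (u - v)).mul continuous_const).tendsto _).eventually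
      (lt_mem_nhds ?_)
    simp only [Pi.mul_apply]
    rw [det2_smul_left, mul_assoc]
    exact mul_pos ht (mul_self_pos.2 h.orient_ne)
  have h2 : ∀ᶠ d in 𝓝 (t • (w - v)), 0 < det2 d (u' - v) * orient v w u' := by
    refine (((continuous_det2_left (u' - v)).mul continuous_const).tendsto _).eventually
      (lt_mem_nhds ?_)
    simp only [Pi.mul_apply]
    rw [det2_smul_left, mul_assoc]
    exact mul_pos ht (mul_self_pos.2 h'.orient_ne)
  filter_upwards [h1, h2] with d hd1 hd2
  rw [Set.mem_union, mem_cone_iff h, mem_cone_iff h']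
  -- If `d` were in neither cone, `det2 (w - v) d` would have sign opposite to both orientations,
  -- but these have opposite signs.
  by_contra hcon
  push Not at hcon
  have a1 := hcon.1 hd1.le
  have a2 := hcon.2 hd2.le
  nlinarith [mul_pos_of_neg_of_neg a1 a2, sq_nonneg (det2 (w - v) d)]

/-- A nonempty finite family of triangles at `v` in which every edge at `v` is shared covers all
directions. -/
lemma exists_mem_cone_of_shared {C : Set (Finset Plane)} (hfin : C.Finite) (hne : C.Nonempty)
    (hC : ∀ s ∈ C, ∃ w u, s = {v, w, u} ∧ IsTri Δ v w u)
    (hshare : ∀ w u, IsTri Δ v w u → {v, w, u} ∈ C →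
      ∃ u', u' ≠ u ∧ IsTri Δ v w u' ∧ {v, w, u'} ∈ C) {d : Plane} (hd : d ≠ 0) :
    ∃ s ∈ C, d ∈ cone v s := by
  set S : Set Plane := ⋃ s ∈ C, cone v s with hS
  have hclosed : IsClosed S := by
    refine hfin.isClosed_biUnion fun s hs => ?_
    obtain ⟨w, u, rfl, hT⟩ := hC s hs
    exact isClosed_cone hT
  have hopen : ∀ d ∈ S, d ≠ 0 → S ∈ 𝓝 d := by
    intro d hdS hd0
    obtain ⟨s, hs, hds⟩ := Set.mem_iUnion₂.1 hdS
    obtain ⟨w, u, rfl, hT⟩ := hC s hs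
    have key : ∀ w u, IsTri Δ v w u → {v, w, u} ∈ C → d ∈ cone v {v, w, u} →
        det2 (w - v) d = 0 → S ∈ 𝓝 d := by
      intro w u hT hs hds h0
      obtain ⟨u', hu', hT', hs'⟩ := hshare w u hT hs
      obtain ⟨a, rfl⟩ := exists_eq_smul_of_det2_eq_zero (sub_ne_zero.2 hT.ne₁₂.symm) h0
      have ha : 0 < a := by
        have h1 := ((mem_cone_iff hT).1 hds).1
        rw [det2_smul_left, mul_assoc] at h1
        have hsq : 0 < orient v w u * orient v w u := mul_self_pos.2 hT.orient_ne
        have h2 : 0 ≤ a := by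
          by_contra hneg
          exact absurd h1 (not_le.2 (mul_neg_of_neg_of_pos (not_le.1 hneg) hsq))
        refine lt_of_le_of_ne h2 ?_
        rintro rfl
        simp at hd0
      filter_upwards [cone_union_mem_nhds hT hT' hu'.symm ha] with x hx
      rcases hx with hx | hx
      · exact Set.mem_biUnion hs hx
      · exact Set.mem_biUnion hs' hx
    by_cases h1 : det2 (w - v) d = 0
    · exact key w u hT hs hds h1
    by_cases h2 : det2 d (u - v) = 0
    · refine key u w hT.swap ?_ ?_ ?_
      · rwa [Finset.pair_comm]
      · rwa [Finset.pair_comm]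
      · rw [det2_swap, h2, neg_zero]
    obtain ⟨g1, g2⟩ := (mem_cone_iff hT).1 hds
    have g1' := lt_of_le_of_ne g1 (mul_ne_zero h2 hT.orient_ne).symm
    have g2' := lt_of_le_of_ne g2 (mul_ne_zero h1 hT.orient_ne).symm
    have e1 : ∀ᶠ x in 𝓝 d, 0 < det2 x (u - v) * orient v w u :=
      (((continuous_det2_left (u - v)).mul continuous_const).tendsto _).eventually
        (lt_mem_nhds g1')
    have e2 : ∀ᶠ x in 𝓝 d, 0 < det2 (w - v) x * orient v w u :=
      (((continuous_det2_right (w - v)).mul continuous_const).tendsto _).eventually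
        (lt_mem_nhds g2')
    filter_upwards [e1, e2] with x hx1 hx2
    exact Set.mem_biUnion hs ((mem_cone_iff hT).2 ⟨hx1.le, hx2.le⟩)
  -- Away from the origin `S` is open and closed, and the punctured plane is connected.
  have hconn : IsPreconnected ({0}ᶜ : Set Plane) :=
    (isConnected_compl_singleton_of_one_lt_rank (by
      rw [← Module.finrank_eq_rank]; simp) 0).isPreconnected
  have hsub : ({0}ᶜ : Set Plane) ⊆ interior S := by
    refine hconn.subset_left_of_subset_union isOpen_interior hclosed.isOpen_compl
      (Set.disjoint_left.2 fun x hx hx' => hx' (interior_subset hx)) ?_ ?_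
    · intro x hx
      by_cases hxS : x ∈ S
      · exact Or.inl (mem_interior_iff_mem_nhds.2 (hopen x hxS hx))
      · exact Or.inr hxS
    · obtain ⟨s, hs⟩ := hne
      obtain ⟨w, u, rfl, hT⟩ := hC s hs
      have hw : w - v ≠ 0 := sub_ne_zero.2 hT.ne₁₂.symm
      refine ⟨w - v, hw, mem_interior_iff_mem_nhds.2 (hopen _ (Set.mem_biUnion hs ?_) hw)⟩
      rw [mem_cone_iff hT, det2_self, zero_mul]
      exact ⟨mul_self_nonneg _, le_rfl⟩
  obtain ⟨s, hs, hds⟩ := Set.mem_iUnion₂.1 (interior_subset (hsub hd))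
  exact ⟨s, hs, hds⟩

lemma exists_forall_mem_convexHull_of_mem_cone {s : Finset Plane} (hv : v ∈ s) {d : Plane}
    (hd : d ∈ cone v s) :
    ∃ ε₀ : ℝ, 0 < ε₀ ∧ ∀ ε, 0 ≤ ε → ε ≤ ε₀ → v + ε • d ∈ convexHull ℝ (s : Set Plane) := by
  obtain ⟨ε₀, h0, hx⟩ := hd
  refine ⟨ε₀, h0, fun ε hε hle => ?_⟩
  have hv' : v ∈ convexHull ℝ (s : Set Plane) := subset_convexHull ℝ _ hv
  have := (convex_convexHull ℝ (s : Set Plane)).add_smul_mem hv' hx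
    (t := ε / ε₀) ⟨by positivity, (div_le_one h0).2 hle⟩
  rwa [smul_smul, div_mul_cancel₀ _ h0.ne'] at this

/-- This direction points strictly inside the angle at `v`, so the two triangles share points near
`v` that lie on neither edge. Simplices meet in a common face, so omitting `w` or `u` from `s` would
force these points onto an edge. -/
lemma eq_of_add_mem_cone {s : Finset Plane} (hs : s ∈ Δ.faces) (hc : s.card = 3) (hv : v ∈ s)
    (hT : IsTri Δ v w u) (h : (w - v) + (u - v) ∈ cone v s) : s = {v, w, u} := by
  have key : ∀ w u, IsTri Δ v w u → (w - v) + (u - v) ∈ cone v s → w ∈ s := by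
    intro w u hT h
    by_contra hw
    obtain ⟨ε₀, h0, hε⟩ := exists_forall_mem_convexHull_of_mem_cone hv h
    set ε := min ε₀ (1 / 2) with hεdef
    have hpos : 0 < ε := lt_min h0 (by norm_num)
    have hle : ε ≤ 1 / 2 := min_le_right _ _
    have hx := hε ε hpos.le (min_le_left _ _)
    have hx' : v + ε • ((w - v) + (u - v)) ∈
        convexHull ℝ (({v, w, u} : Finset Plane) : Set Plane) :=
      mem_convexHull_triple.2 ⟨ε, ε, hpos.le, hpos.le, by linarith, by rw [smul_add]⟩
    have hmem := mem_convexHull_inter hs hT.mem hx hx'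
    have hsub : ((s ∩ {v, w, u} : Finset Plane) : Set Plane) ⊆ {v, u} := by
      intro y hy
      simp only [Finset.coe_inter, Finset.coe_insert, Finset.coe_singleton, Set.mem_inter_iff,
        Set.mem_insert_iff, Set.mem_singleton_iff, Finset.mem_coe] at hy ⊢
      rcases hy with ⟨h1, rfl | rfl | rfl⟩
      · exact Or.inl rfl
      · exact absurd h1 hw
      · exact Or.inr rfl
    have h0 := det2_eq_zero_of_mem_convexHull_pair (convexHull_mono hsub hmem)
    rw [add_sub_cancel_left, det2_smul_right, det2_add_right, det2_self, add_zero] at h0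
    exact mul_ne_zero hpos.ne' hT.swap.orient_ne h0
  have h1 := key w u hT h
  have h2 := key u w hT.swap (by rwa [add_comm])
  refine (Finset.eq_of_subset_of_card_le ?_ ?_).symm
  · intro y hy
    simp only [Finset.mem_insert, Finset.mem_singleton] at hy
    rcases hy with rfl | rfl | rfl <;> assumption
  · rw [hc, hT.card]

end Geometry

/-! ### Triangles around a vertex: boundary edges, fluxes and fans. -/

section Fans

variable {Δ : SimplicialComplex ℝ Plane} {v w u : Plane}

/-- The triangles of the complex. -/
def triangles (Δ : SimplicialComplex ℝ Plane) : Set (Finset Plane) :=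
  {s | s ∈ Δ.faces ∧ s.card = 3}

lemma IsTri.mem_triangles (h : IsTri Δ v w u) : {v, w, u} ∈ triangles Δ := ⟨h.mem, h.card⟩

lemma isTri_of_mem_triangles (h : {v, w, u} ∈ triangles Δ) : IsTri Δ v w u :=
  isTri_of_card_eq_three h.1 h.2

/-- The edge `v w` lies on the triangle `v w u` and on no other triangle. -/
def IsBdry (Δ : SimplicialComplex ℝ Plane) (v w u : Plane) : Prop :=
  IsTri Δ v w u ∧ ∀ y, IsTri Δ v w y → y = u

lemma IsBdry.swap_left (h : IsBdry Δ v w u) : IsBdry Δ w v u :=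
  ⟨h.1.swap_left, fun y hy => h.2 y hy.swap_left⟩

lemma IsTri.pair_mem (h : IsTri Δ v w u) : {v, w} ∈ Δ.faces :=
  Δ.down_closed h.mem (by grind) (by simp)

lemma IsTri.singleton_mem (h : IsTri Δ v w u) : {v} ∈ Δ.faces :=
  Δ.down_closed h.mem (by simp) (by simp)

lemma existsUnique_triangle_iff (hne : v ≠ w) :
    (∃! σ : Finset Plane, σ ∈ Δ.faces ∧ σ.card = 3 ∧ {v, w} ⊆ σ) ↔ ∃ u, IsBdry Δ v w u := by
  constructor
  · rintro ⟨σ, ⟨hσ, hc, hsub⟩, huniq⟩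
    obtain ⟨u, rfl, hT⟩ := exists_isTri_of_mem_of_mem hσ hc (hsub (by simp : v ∈ {v, w}))
      (hsub (by simp : w ∈ {v, w})) hne
    refine ⟨u, hT, fun y hy => ?_⟩
    have := huniq {v, w, y} ⟨hy.mem, hy.card, by grind⟩
    have hmem : y ∈ ({v, w, u} : Finset Plane) := by rw [← this]; simp
    simp only [Finset.mem_insert, Finset.mem_singleton] at hmem
    rcases hmem with h | h | h
    · exact absurd h.symm hy.ne₁₃
    · exact absurd h.symm hy.ne₂₃
    · exact h
  · rintro ⟨u, hT, huniq⟩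
    refine ⟨{v, w, u}, ⟨hT.mem, hT.card, by grind⟩, ?_⟩
    rintro σ ⟨hσ, hc, hsub⟩
    obtain ⟨y, rfl, hy⟩ := exists_isTri_of_mem_of_mem hσ hc (hsub (by simp : v ∈ {v, w}))
      (hsub (by simp : w ∈ {v, w})) hne
    rw [huniq y hy]

lemma pair_mem_boundaryFaces_iff (hne : v ≠ w) :
    {v, w} ∈ boundaryFaces Δ ↔ ∃ u, IsBdry Δ v w u := by
  rw [← existsUnique_triangle_iff hne]
  constructor
  · rintro ⟨-, τ, hτ, hc, hsub, hu⟩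
    have : ({v, w} : Finset Plane) = τ :=
      Finset.eq_of_subset_of_card_le hsub (by rw [hc, Finset.card_pair hne])
    rwa [this]
  · intro h
    obtain ⟨u, hT, -⟩ := (existsUnique_triangle_iff hne).1 h
    exact ⟨hT.pair_mem, _, hT.pair_mem, Finset.card_pair hne, subset_rfl, h⟩

lemma singleton_mem_boundaryFaces_iff :
    {v} ∈ boundaryFaces Δ ↔ ∃ w u, IsBdry Δ v w u := by
  constructor
  · rintro ⟨-, τ, hτ, hc, hsub, hu⟩
    obtain ⟨a, b, hab, rfl⟩ := Finset.card_eq_two.1 hc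
    have hv : v ∈ ({a, b} : Finset Plane) := hsub (by simp)
    obtain ⟨u, hB⟩ := (existsUnique_triangle_iff hab).1 hu
    simp only [Finset.mem_insert, Finset.mem_singleton] at hv
    rcases hv with rfl | rfl
    · exact ⟨b, u, hB⟩
    · exact ⟨a, u, hB.swap_left⟩
  · rintro ⟨w, u, hB⟩
    exact ⟨hB.1.singleton_mem, {v, w}, hB.1.pair_mem, Finset.card_pair hB.1.ne₁₂, by simp,
      (existsUnique_triangle_iff hB.1.ne₁₂).2 ⟨u, hB⟩⟩

/-- The finite set of vertices. -/
def verts (hfin : Δ.faces.Finite) : Finset Plane := hfin.toFinset.biUnion id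

lemma mem_verts_of_mem {hfin : Δ.faces.Finite} {s : Finset Plane} (hs : s ∈ Δ.faces)
    (hv : v ∈ s) : v ∈ verts hfin :=
  Finset.mem_biUnion.2 ⟨s, hfin.mem_toFinset.2 hs, hv⟩

lemma mem_verts {hfin : Δ.faces.Finite} : v ∈ verts hfin ↔ {v} ∈ Δ.faces := by
  constructor
  · intro h
    obtain ⟨s, hs, hv⟩ := Finset.mem_biUnion.1 h
    exact Δ.down_closed (hfin.mem_toFinset.1 hs) (by simpa using hv) (by simp)
  · intro h
    exact mem_verts_of_mem h (by simp)

section Flux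

variable {M : Type*} [AddCommGroup M] [Module ℝ M]

/-- The signed sum over the triangles at the oriented edge `v w`. -/
def flux (hfin : Δ.faces.Finite) (g : Finset Plane → M) (v w : Plane) : M :=
  ∑ u ∈ verts hfin, Real.sign (orient v w u) • g {v, w, u}

variable (hfin : Δ.faces.Finite) {g : Finset Plane → M}

lemma flux_swap (g : Finset Plane → M) (v w : Plane) :
    flux hfin g w v = -flux hfin g v w := by
  unfold flux
  rw [← Finset.sum_neg_distrib]
  refine Finset.sum_congr rfl fun u _ => ?_
  rw [orient_swap_left, Real.sign_neg, neg_smul, Finset.insert_comm]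

/-- Each triangle `v w u` is counted at its edges `v w` and `v u`, with opposite signs. -/
lemma sum_flux (g : Finset Plane → M) (v : Plane) :
    ∑ w ∈ verts hfin, flux hfin g v w = 0 := by
  have h : ∑ w ∈ verts hfin, flux hfin g v w = -∑ w ∈ verts hfin, flux hfin g v w := by
    unfold flux
    conv_lhs => rw [Finset.sum_comm]
    rw [← Finset.sum_neg_distrib]
    refine Finset.sum_congr rfl fun w _ => ?_
    rw [← Finset.sum_neg_distrib]
    refine Finset.sum_congr rfl fun u _ => ?_
    rw [orient_swap, Real.sign_neg, neg_smul, Finset.pair_comm]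
  have h2 : (2 : ℝ) • ∑ w ∈ verts hfin, flux hfin g v w = 0 := by
    rw [two_smul]
    nth_rewrite 1 [h]
    exact neg_add_cancel _
  exact (smul_eq_zero.1 h2).resolve_left two_ne_zero

lemma flux_eq_zero (hg : ∀ s, s ∉ triangles Δ → g s = 0) (h : ∀ u, ¬ IsTri Δ v w u) :
    flux hfin g v w = 0 := by
  refine Finset.sum_eq_zero fun u _ => ?_
  rw [hg _ fun hs => h u (isTri_of_mem_triangles hs), smul_zero]

lemma flux_of_isBdry (hg : ∀ s, s ∉ triangles Δ → g s = 0) (h : IsBdry Δ v w u) :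
    flux hfin g v w = Real.sign (orient v w u) • g {v, w, u} := by
  refine Finset.sum_eq_single_of_mem u (mem_verts_of_mem h.1.mem (by simp)) fun y _ hy => ?_
  rw [hg _ fun hs => hy (h.2 y (isTri_of_mem_triangles hs)), smul_zero]

lemma sign_orient_eq_neg {u' : Plane} (h : IsTri Δ v w u) (h' : IsTri Δ v w u') (hne : u ≠ u') :
    Real.sign (orient v w u') = -Real.sign (orient v w u) := by
  rcases mul_neg_iff.1 (orient_mul_orient_neg h h' hne) with ⟨h1, h2⟩ | ⟨h1, h2⟩
  · rw [Real.sign_of_pos h1, Real.sign_of_neg h2]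
  · rw [Real.sign_of_neg h1, Real.sign_of_pos h2, neg_neg]

/-- A line has only two sides, so three triangles at an edge cannot lie pairwise on opposite sides
of it. -/
lemma eq_or_eq_of_isTri {u' y : Plane} (h : IsTri Δ v w u) (h' : IsTri Δ v w u') (hne : u ≠ u')
    (hy : IsTri Δ v w y) : y = u ∨ y = u' := by
  by_contra hcon
  push Not at hcon
  have h1 := orient_mul_orient_neg h h' hne
  have h2 := orient_mul_orient_neg hy h hcon.1
  have h3 := orient_mul_orient_neg hy h' hcon.2
  nlinarith [mul_pos_of_neg_of_neg h2 h3, sq_nonneg (orient v w y)]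

lemma flux_of_two {u' : Plane} (hg : ∀ s, s ∉ triangles Δ → g s = 0) (h : IsTri Δ v w u)
    (h' : IsTri Δ v w u') (hne : u ≠ u') :
    flux hfin g v w = Real.sign (orient v w u) • (g {v, w, u} - g {v, w, u'}) := by
  have hsub : ({u, u'} : Finset Plane) ⊆ verts hfin := by
    intro y hy
    simp only [Finset.mem_insert, Finset.mem_singleton] at hy
    rcases hy with rfl | rfl
    · exact mem_verts_of_mem h.mem (by simp)
    · exact mem_verts_of_mem h'.mem (by simp)
  unfold flux
  rw [← Finset.sum_subset hsub, Finset.sum_pair hne, sign_orient_eq_neg h h' hne, smul_sub,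
    neg_smul, sub_eq_add_neg]
  intro y _ hy
  simp only [Finset.mem_insert, Finset.mem_singleton] at hy
  rw [hg _ fun hs => hy (eq_or_eq_of_isTri h h' hne (isTri_of_mem_triangles hs)), smul_zero]

end Flux

/-- A family of triangles at `v` closed under passing to the other triangle at an edge
through `v`. -/
structure IsFan (Δ : SimplicialComplex ℝ Plane) (v : Plane) (C : Set (Finset Plane)) : Prop where
  subset : ∀ s ∈ C, s ∈ triangles Δ ∧ v ∈ s
  closed : ∀ w u u', IsTri Δ v w u → IsTri Δ v w u' → {v, w, u} ∈ C → {v, w, u'} ∈ C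

/-- A fan without boundary edges contains all triangles at its vertex, and covers all
directions. -/
lemma IsFan.mem_of_forall_exists {C : Set (Finset Plane)} (hfin : Δ.faces.Finite)
    (hC : IsFan Δ v C) (hne : C.Nonempty)
    (hint : ∀ w u, IsTri Δ v w u → {v, w, u} ∈ C → ¬ IsBdry Δ v w u) :
    (∀ d : Plane, d ≠ 0 → ∃ s ∈ C, d ∈ cone v s) ∧ ∀ w u, IsTri Δ v w u → {v, w, u} ∈ C := by
  have hcov : ∀ d : Plane, d ≠ 0 → ∃ s ∈ C, d ∈ cone v s := by
    intro d hd
    refine exists_mem_cone_of_shared (hfin.subset fun s hs => (hC.subset s hs).1.1) hne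
      (fun s hs => exists_isTri_of_mem (hC.subset s hs).1.1 (hC.subset s hs).1.2
        (hC.subset s hs).2) ?_ hd
    intro w u hT hs
    have := hint w u hT hs
    simp only [IsBdry, hT, true_and, not_forall] at this
    obtain ⟨y, hy, hne⟩ := this
    exact ⟨y, hne, hy, hC.closed w u y hT hy hs⟩
  refine ⟨hcov, fun w u hT => ?_⟩
  have hne : (w - v) + (u - v) ≠ 0 := by
    intro h0
    have := congrArg (det2 (w - v)) h0
    rw [det2_add_right, det2_self, zero_add, det2_zero_right] at this
    exact hT.orient_ne this
  obtain ⟨s, hs, hd⟩ := hcov _ hne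
  rw [← eq_of_add_mem_cone (hC.subset s hs).1.1 (hC.subset s hs).1.2 (hC.subset s hs).2 hT hd]
  exact hs

/-- A fan at a boundary vertex contains a triangle at an outgoing boundary edge. -/
lemma IsFan.exists_isBdry {C : Set (Finset Plane)} (hfin : Δ.faces.Finite)
    (hC : IsFan Δ v C) (hne : C.Nonempty) (hv : ∃ w u, IsBdry Δ v w u) :
    ∃ w u, IsBdry Δ v w u ∧ 0 < orient v w u ∧ {v, w, u} ∈ C := by
  by_contra hcon
  push Not at hcon
  -- The flux of the indicator of the fan vanishes except at boundary edges of the fan, where it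
  -- would be `-1` by `hcon`. The fluxes at `v` sum to zero, so the fan has no boundary edge at `v`;
  -- then it is the whole star and contains the triangle at a boundary edge after all.
  set g : Finset Plane → ℝ := fun s => if s ∈ C then 1 else 0 with hg
  have hg0 : ∀ s, s ∉ triangles Δ → g s = 0 := fun s hs => by
    simp only [hg]
    rw [if_neg fun h => hs (hC.subset s h).1]
  have hbd : ∀ w u, IsBdry Δ v w u → {v, w, u} ∈ C → flux hfin g v w = -1 := by
    intro w u hB hs
    have hlt : orient v w u < 0 :=
      lt_of_le_of_ne (not_lt.1 fun h => hcon w u hB h hs) hB.1.orient_ne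
    rw [flux_of_isBdry hfin hg0 hB, Real.sign_of_neg hlt]
    simp [hg, hs]
  have hle : ∀ w ∈ verts hfin, flux hfin g v w ≤ 0 := by
    intro w _
    by_cases hex : ∃ u, IsTri Δ v w u
    · obtain ⟨u, hT⟩ := hex
      by_cases hB : IsBdry Δ v w u
      · by_cases hs : {v, w, u} ∈ C
        · rw [hbd w u hB hs]; norm_num
        · rw [flux_of_isBdry hfin hg0 hB]
          simp [hg, hs]
      · simp only [IsBdry, hT, true_and, not_forall] at hB
        obtain ⟨y, hy, hne⟩ := hB
        rw [flux_of_two hfin hg0 hT hy (Ne.symm hne)]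
        have : g {v, w, u} = g {v, w, y} := by
          have : {v, w, u} ∈ C ↔ {v, w, y} ∈ C := ⟨hC.closed w u y hT hy, hC.closed w y u hy hT⟩
          simp [hg, this]
        rw [this, sub_self, smul_zero]
    · push Not at hex
      rw [flux_eq_zero hfin hg0 hex]
  have hzero := (Finset.sum_eq_zero_iff_of_nonpos hle).1 (sum_flux hfin g v)
  have hall := (hC.mem_of_forall_exists hfin hne fun w u hT hs hB => by
    have h1 := hzero w (mem_verts_of_mem hT.mem (by simp))
    rw [hbd w u hB hs] at h1
    norm_num at h1).2
  obtain ⟨w, u, hB⟩ := hv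
  have h1 := hzero w (mem_verts_of_mem hB.1.mem (by simp))
  rw [hbd w u hB (hall w u hB.1)] at h1
  norm_num at h1

/-- A nonempty fan at an interior vertex is the whole star. -/
lemma IsFan.mem_of_interior {C : Set (Finset Plane)} (hfin : Δ.faces.Finite)
    (hC : IsFan Δ v C) (hne : C.Nonempty) (hv : ¬ ∃ w u, IsBdry Δ v w u) (hT : IsTri Δ v w u) :
    {v, w, u} ∈ C :=
  (hC.mem_of_forall_exists hfin hne fun w u _ _ hB => hv ⟨w, u, hB⟩).2 w u hT

lemma isFan_star (v : Plane) : IsFan Δ v {s | s ∈ triangles Δ ∧ v ∈ s} where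
  subset := fun _ hs => hs
  closed := fun _ _ _ _ h' _ => ⟨h'.mem_triangles, by simp⟩

/-- An interior vertex has a neighbour that lies strictly to the right of it. -/
lemma exists_isTri_right (hfin : Δ.faces.Finite) (hstar : ∃ w u, IsTri Δ v w u)
    (hv : ¬ ∃ w u, IsBdry Δ v w u) : ∃ w u, IsTri Δ v w u ∧ v 0 < w 0 := by
  obtain ⟨w, u, hT⟩ := hstar
  -- The star covers the direction `(1, 0)`, a nonnegative combination of two edges at `v`, one of
  -- which must point to the right.
  obtain ⟨s, ⟨hs, hvs⟩, ε, hε, hx⟩ := ((isFan_star v).mem_of_forall_exists hfin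
    ⟨{v, w, u}, hT.mem_triangles, by simp⟩ fun w u _ _ hB => hv ⟨w, u, hB⟩).1
    (EuclideanSpace.single (0 : Fin 2) (1 : ℝ)) (by simp)
  obtain ⟨w, u, rfl, hT⟩ := exists_isTri_of_mem hs.1 hs.2 hvs
  obtain ⟨a, b, ha, hb, -, he⟩ := mem_convexHull_triple.1 hx
  have h0 := congrArg (fun x : Plane => x 0) (add_left_cancel he)
  simp at h0
  by_cases h1 : v 0 < w 0
  · exact ⟨w, u, hT, h1⟩
  by_cases h2 : v 0 < u 0
  · exact ⟨u, w, hT.swap, h2⟩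
  exfalso
  push Not at h1 h2
  nlinarith [mul_nonneg ha (sub_nonneg.2 h1), mul_nonneg hb (sub_nonneg.2 h2)]

end Fans

/-! ### Vanishing first cohomology and the Euler characteristic. -/

section Euler

variable {Δ : SimplicialComplex ℝ Plane} {v w u : Plane}

lemma finite_triangles (hfin : Δ.faces.Finite) : (triangles Δ).Finite :=
  hfin.subset fun _ hs => hs.1

lemma space_eq_iUnion_triangles (hpure : IsPure Δ) :
    Δ.space = ⋃ s : triangles Δ, convexHull ℝ ((s : Finset Plane) : Set Plane) := by
  ext x
  rw [Δ.mem_space_iff, Set.mem_iUnion]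
  constructor
  · rintro ⟨s, hs, hx⟩
    obtain ⟨σ, hσ, hc, hsub⟩ := hpure s hs
    exact ⟨⟨σ, hσ, hc⟩, convexHull_mono (by exact_mod_cast hsub) hx⟩
  · rintro ⟨s, hx⟩
    exact ⟨s, s.2.1, hx⟩

lemma exists_triangle_of_mem_space (hpure : IsPure Δ) (x : Δ.space) :
    ∃ s : triangles Δ, (x : Plane) ∈ convexHull ℝ ((s : Finset Plane) : Set Plane) := by
  exact Set.mem_iUnion.1 ((space_eq_iUnion_triangles hpure).le x.2)

lemma isClosed_convexHull_finset (s : Finset Plane) :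
    IsClosed (convexHull ℝ (s : Set Plane)) :=
  (s.finite_toSet.isCompact_convexHull ℝ).isClosed

/-- Two edges of a triangle form a basis of the plane, so their values prescribe `L`; the cocycle
condition supplies the third edge. -/
lemma exists_linearMap_of_cocycle {c : Plane → Plane → ℤ} (hanti : ∀ v w, c w v = -c v w)
    (hcoc : ∀ v w u, IsTri Δ v w u → c v w + c w u + c u v = 0) (s : triangles Δ) :
    ∃ L : Plane →ₗ[ℝ] ℝ, ∀ x ∈ (s : Finset Plane), ∀ y ∈ (s : Finset Plane),
      L y - L x = c x y := by
  obtain ⟨s, hs⟩ := s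
  have hself : ∀ x, c x x = 0 := fun x => by have := hanti x x; omega
  obtain ⟨v, w, u, -, -, -, rfl⟩ := Finset.card_eq_three.1 hs.2
  have hT := isTri_of_mem_triangles hs
  have hD := hT.orient_ne
  let L : Plane →ₗ[ℝ] ℝ :=
    { toFun := fun d => c v w * (det2 d (u - v) / orient v w u)
        + c v u * (det2 (w - v) d / orient v w u)
      map_add' := fun a b => by rw [det2_add_left, det2_add_right]; ring
      map_smul' := fun t a => by
        rw [det2_smul_left, det2_smul_right, RingHom.id_apply, smul_eq_mul]; ring }
  have hw : L w - L v = c v w := by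
    rw [← map_sub]
    change (c v w : ℝ) * (orient v w u / orient v w u) + c v u * (det2 (w - v) (w - v) / _) = _
    rw [det2_self, div_self hD]; ring
  have hu : L u - L v = c v u := by
    rw [← map_sub]
    change (c v w : ℝ) * (det2 (u - v) (u - v) / _) + c v u * (orient v w u / orient v w u) = _
    rw [det2_self, div_self hD]; ring
  have h3 : (c v w : ℝ) + c w u + c u v = 0 := by exact_mod_cast hcoc v w u hT
  have a1 : (c w v : ℝ) = -c v w := by exact_mod_cast hanti v w
  have a2 : (c u v : ℝ) = -c v u := by exact_mod_cast hanti v u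
  have a3 : (c u w : ℝ) = -c w u := by exact_mod_cast hanti w u
  refine ⟨L, fun x hx y hy => ?_⟩
  simp only [Finset.mem_insert, Finset.mem_singleton] at hx hy
  rcases hx with rfl | rfl | rfl <;> rcases hy with rfl | rfl | rfl <;>
    first
    | (rw [hself]; simp)
    | linarith

/-- On a contractible complex every integral `1`-cocycle is a coboundary. -/
theorem exists_potential (hfin : Δ.faces.Finite) (hpure : IsPure Δ)
    (hcontr : ContractibleSpace Δ.space) {c : Plane → Plane → ℤ}
    (hanti : ∀ v w, c w v = -c v w)
    (hcoc : ∀ v w u, IsTri Δ v w u → c v w + c w u + c u v = 0) :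
    ∃ g : Plane → ℤ, ∀ v w, {v, w} ∈ Δ.faces → c v w = g w - g v := by
  choose L hL using exists_linearMap_of_cocycle hanti hcoc
  have hne : ∀ s : triangles Δ, (s : Finset Plane).Nonempty := fun s =>
    Δ.nonempty_of_mem_faces s.2.1
  choose b hb using hne
  -- Normalised to vanish at a vertex, `h s` is integral at all vertices of `s`. On a common face,
  -- `h s` and `h t` thus differ by a constant integer and agree in the circle.
  set h : triangles Δ → Plane → ℝ := fun s x => L s x - L s (b s) with hh
  have hcont : ∀ s, Continuous (h s) := fun s =>
    (LinearMap.continuous_of_finiteDimensional (L s)).sub continuous_const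
  have hcompat : ∀ s t : triangles Δ, ∀ x : Plane,
      x ∈ convexHull ℝ ((s : Finset Plane) : Set Plane) →
      x ∈ convexHull ℝ ((t : Finset Plane) : Set Plane) →
      (h s x : AddCircle (1 : ℝ)) = h t x := by
    intro s t x hxs hxt
    have hx := mem_convexHull_inter s.2.1 t.2.1 hxs hxt
    obtain ⟨y, hy⟩ : ((s : Finset Plane) ∩ t : Finset Plane).Nonempty := by
      rw [← Finset.coe_nonempty, ← convexHull_nonempty_iff (𝕜 := ℝ)]
      exact ⟨x, hx⟩
    have hsub : (((s : Finset Plane) ∩ t : Finset Plane) : Set Plane) ⊆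
        {z | (L s - L t) z = (L s - L t) y} := by
      intro z hz
      rw [Finset.mem_coe, Finset.mem_inter] at hz
      rw [Finset.mem_inter] at hy
      have h1 := hL s y hy.1 z hz.1
      have h2 := hL t y hy.2 z hz.2
      simp only [Set.mem_ofPred_eq, LinearMap.sub_apply]
      linarith
    have hxy := convexHull_min hsub (convex_hyperplane (L s - L t).isLinear _) hx
    simp only [Set.mem_ofPred_eq, LinearMap.sub_apply] at hxy
    rw [Finset.mem_inter] at hy
    have h1 := hL s (b s) (hb s) y hy.1
    have h2 := hL t (b t) (hb t) y hy.2
    rw [← sub_eq_zero, ← AddCircle.coe_sub, AddCircle.coe_eq_zero_iff]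
    refine ⟨c (b s) y - c (b t) y, ?_⟩
    simp only [hh, zsmul_eq_mul, mul_one]
    push_cast
    linarith
  choose τ hτ using exists_triangle_of_mem_space hpure
  let F : Plane → AddCircle (1 : ℝ) := fun x => if hx : x ∈ Δ.space then h (τ ⟨x, hx⟩) x else 0
  have hF : ∀ s : triangles Δ, ∀ x ∈ convexHull ℝ ((s : Finset Plane) : Set Plane),
      F x = h s x := by
    intro s x hx
    have hxs : x ∈ Δ.space := Δ.convexHull_subset_space s.2.1 hx
    simp only [F, dif_pos hxs]
    exact hcompat _ _ _ (hτ ⟨x, hxs⟩) hx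
  have hFc : ContinuousOn F Δ.space := by
    have : Finite (triangles Δ) := finite_triangles hfin
    rw [space_eq_iUnion_triangles hpure]
    refine (locallyFinite_of_finite _).continuousOn_iUnion
      (fun s => isClosed_convexHull_finset s) fun s => ?_
    exact ((AddCircle.continuous_mk' (1 : ℝ)).comp (hcont s)).continuousOn.congr (hF s)
  let f : C(Δ.space, AddCircle (1 : ℝ)) := ⟨_, hFc.domRestrict⟩
  -- Contracting the space makes `f` homotopic to a constant, which lifts to `ℝ`; lifting the
  -- homotopy and restricting to its end lifts `f`.
  obtain ⟨y, hy⟩ := id_nullhomotopic Δ.space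
  obtain ⟨H⟩ := hy.symm
  obtain ⟨e, he⟩ := QuotientAddGroup.mk_surjective (f y)
  have cov := AddCircle.isCoveringMap_coe (1 : ℝ)
  have H0 : ∀ a, f.comp H.toContinuousMap (0, a) =
      (ContinuousMap.const Δ.space e a : AddCircle (1 : ℝ)) := by
    intro a
    rw [ContinuousMap.comp_apply, ContinuousMap.const_apply]
    exact (congrArg f (H.apply_zero a)).trans he.symm
  let G := cov.liftHomotopy (f.comp H.toContinuousMap) (ContinuousMap.const _ e) H0
  have hG : ∀ x : Δ.space, (G (1, x) : AddCircle (1 : ℝ)) = F x := by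
    intro x
    have := congrFun (cov.liftHomotopy_lifts (f.comp H.toContinuousMap)
      (ContinuousMap.const _ e) H0) (1, x)
    refine this.trans ?_
    change f (H (1, x)) = f x
    rw [H.apply_one]; rfl
  let g : Plane → ℝ := fun x => if hx : x ∈ Δ.space then G (1, ⟨x, hx⟩) else 0
  have hgc : ContinuousOn g Δ.space := by
    rw [continuousOn_iff_continuous_domRestrict]
    have : Continuous fun x : Δ.space => G (1, x) := by fun_prop
    refine this.congr fun x => ?_
    simp [g]
  have hg : ∀ s : triangles Δ, ∀ x ∈ (s : Finset Plane), ∀ y ∈ (s : Finset Plane),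
      g y - g x = c x y := by
    intro s x hx y hy
    have hsub := Δ.convexHull_subset_space s.2.1
    -- On a triangle `g` and `h s` lift the same circle-valued map, so their difference is constant
    -- there.
    have := cov.constOn_of_comp (convex_convexHull ℝ ((s : Finset Plane) : Set Plane)).isPreconnected
      (g := fun z => g z - h s z) ((hgc.mono hsub).sub (hcont s).continuousOn) (by
        have : ∀ a ∈ convexHull ℝ ((s : Finset Plane) : Set Plane),
            ((g a - h s a : ℝ) : AddCircle (1 : ℝ)) = 0 := by
          intro a ha
          rw [AddCircle.coe_sub, ← hF s a ha, sub_eq_zero]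
          simp only [g, dif_pos (hsub ha)]
          exact hG ⟨a, hsub ha⟩
        intro a ha a' ha'
        rw [this a ha, this a' ha']) (subset_convexHull ℝ _ hx) (subset_convexHull ℝ _ hy)
    have h1 := hL s x hx y hy
    simp only [hh] at this
    linarith
  -- The real potential has integral differences along edges, which the floor preserves.
  refine ⟨fun x => ⌊g x⌋, fun v w hvw => ?_⟩
  obtain ⟨σ, hσ, hc, hsub⟩ := hpure _ hvw
  have := hg ⟨σ, hσ, hc⟩ v (hsub (by simp)) w (hsub (by simp))
  have hw : g w = g v + c v w := by linarith
  simp only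
  rw [hw, Int.floor_add_intCast]
  ring

/-- Over the rationals as well, every `1`-cocycle on a contractible complex is a coboundary. -/
theorem exists_rat_potential (hfin : Δ.faces.Finite) (hpure : IsPure Δ)
    (hcontr : ContractibleSpace Δ.space) {c : Plane → Plane → ℚ}
    (hanti : ∀ v w, c w v = -c v w)
    (hcoc : ∀ v w u, IsTri Δ v w u → c v w + c w u + c u v = 0) :
    ∃ g : Plane → ℚ, ∀ v w, {v, w} ∈ Δ.faces → c v w = g w - g v := by
  -- Clearing all denominators reduces to integral cocycles.
  set N : ℕ := ∏ e ∈ verts hfin ×ˢ verts hfin, (c e.1 e.2).den with hN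
  have hN0 : (N : ℚ) ≠ 0 := by
    rw [Nat.cast_ne_zero, hN]
    exact Finset.prod_ne_zero_iff.2 fun e _ => (c e.1 e.2).den_nz
  have hint : ∀ v ∈ verts hfin, ∀ w ∈ verts hfin, ∃ n : ℤ, (n : ℚ) = N * c v w := by
    intro v hv w hw
    obtain ⟨m, hm⟩ : (c v w).den ∣ N :=
      Finset.dvd_prod_of_mem (fun e : Plane × Plane => (c e.1 e.2).den)
        (Finset.mk_mem_product hv hw)
    refine ⟨m * (c v w).num, ?_⟩
    rw [hm]
    push_cast
    rw [mul_comm ((c v w).den : ℚ), mul_assoc, Rat.den_mul_eq_num]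
  let c' : Plane → Plane → ℤ := fun v w =>
    if v ∈ verts hfin ∧ w ∈ verts hfin then ⌊N * c v w⌋ else 0
  have hc' : ∀ v ∈ verts hfin, ∀ w ∈ verts hfin, (c' v w : ℚ) = N * c v w := by
    intro v hv w hw
    obtain ⟨n, hn⟩ := hint v hv w hw
    simp only [c', hv, hw, and_self, if_true]
    rw [← hn, Int.floor_intCast]
  obtain ⟨g, hg⟩ := exists_potential hfin hpure hcontr (c := c') (by
      intro v w
      by_cases h : v ∈ verts hfin ∧ w ∈ verts hfin
      · have h1 := hc' v h.1 w h.2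
        have h2 := hc' w h.2 v h.1
        rw [hanti v w] at h2
        have : (c' w v : ℚ) = -c' v w := by rw [h1, h2]; ring
        exact_mod_cast this
      · have h' : ¬ (w ∈ verts hfin ∧ v ∈ verts hfin) := fun h' => h h'.symm
        simp [c', h, h']) (by
      intro v w u hT
      have hv : v ∈ verts hfin := mem_verts_of_mem hT.mem (by simp)
      have hw : w ∈ verts hfin := mem_verts_of_mem hT.mem (by simp)
      have hu : u ∈ verts hfin := mem_verts_of_mem hT.mem (by simp)
      have : (c' v w : ℚ) + c' w u + c' u v = 0 := by
        rw [hc' v hv w hw, hc' w hw u hu, hc' u hu v hv, ← mul_add, ← mul_add, hcoc v w u hT,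
          mul_zero]
      exact_mod_cast this)
  refine ⟨fun x => g x / N, fun v w hvw => ?_⟩
  have hv : v ∈ verts hfin := mem_verts_of_mem hvw (by simp)
  have hw : w ∈ verts hfin := mem_verts_of_mem hvw (by simp)
  have h1 := hc' v hv w hw
  rw [hg v w hvw] at h1
  push_cast at h1
  field_simp
  linarith

/-- The Euler characteristic of a contractible planar complex is at least `1`; the edges are
counted by a choice of one orientation for each. -/
theorem euler_char_ge (hfin : Δ.faces.Finite) (hpure : IsPure Δ)
    (hcontr : ContractibleSpace Δ.space) (E : Finset (Plane × Plane))
    (hE : ∀ e ∈ E, e.1 ≠ e.2 ∧ {e.1, e.2} ∈ Δ.faces)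
    (hor : ∀ v w, v ≠ w → {v, w} ∈ Δ.faces → ((v, w) ∈ E ↔ (w, v) ∉ E)) :
    E.card + 1 ≤ (verts hfin).card + (triangles Δ).ncard := by
  have : Fintype (triangles Δ) := (finite_triangles hfin).fintype
  let ext : (E → ℚ) →ₗ[ℚ] (Plane → Plane → ℚ) :=
    { toFun := fun c v w => if h : (v, w) ∈ E then c ⟨_, h⟩ else
        if h : (w, v) ∈ E then -c ⟨_, h⟩ else 0
      map_add' := fun a b => by
        ext v w
        simp only [Pi.add_apply]
        split_ifs <;> ring
      map_smul' := fun t a => by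
        ext v w
        simp only [Pi.smul_apply, smul_eq_mul, RingHom.id_apply]
        split_ifs <;> ring }
  have hvert : ∀ s : triangles Δ, ∃ t : Plane × Plane × Plane,
      (s : Finset Plane) = {t.1, t.2.1, t.2.2} := by
    intro s
    obtain ⟨v, w, u, -, -, -, h⟩ := Finset.card_eq_three.1 s.2.2
    exact ⟨(v, w, u), h⟩
  choose t ht using hvert
  let δ₁ : (E → ℚ) →ₗ[ℚ] (triangles Δ → ℚ) :=
    { toFun := fun c s => ext c (t s).1 (t s).2.1 + ext c (t s).2.1 (t s).2.2
        + ext c (t s).2.2 (t s).1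
      map_add' := fun a b => by
        ext s; simp only [map_add, Pi.add_apply]; ring
      map_smul' := fun r a => by
        ext s; simp only [map_smul, Pi.smul_apply, smul_eq_mul, RingHom.id_apply]; ring }
  have hEv : ∀ e : E, e.1.1 ∈ verts hfin ∧ e.1.2 ∈ verts hfin := fun e =>
    ⟨mem_verts_of_mem (hE e e.2).2 (by simp), mem_verts_of_mem (hE e e.2).2 (by simp)⟩
  let δ₀ : (verts hfin → ℚ) →ₗ[ℚ] (E → ℚ) :=
    { toFun := fun g e => g ⟨_, (hEv e).2⟩ - g ⟨_, (hEv e).1⟩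
      map_add' := fun a b => by ext e; simp only [Pi.add_apply]; ring
      map_smul' := fun r a => by
        ext e; simp only [Pi.smul_apply, smul_eq_mul, RingHom.id_apply]; ring }
  have hker : LinearMap.ker δ₁ ≤ LinearMap.range δ₀ := by
    intro c hc
    have hc0 : ∀ s, ext c (t s).1 (t s).2.1 + ext c (t s).2.1 (t s).2.2
        + ext c (t s).2.2 (t s).1 = 0 := fun s => congrFun (LinearMap.mem_ker.1 hc) s
    let c' : Plane → Plane → ℚ := fun v w =>
      if v ≠ w ∧ {v, w} ∈ Δ.faces then ext c v w else 0
    have hanti : ∀ v w, c' w v = -c' v w := by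
      intro v w
      by_cases h : v ≠ w ∧ {v, w} ∈ Δ.faces
      · have h' : w ≠ v ∧ {w, v} ∈ Δ.faces := ⟨h.1.symm, by rw [Finset.pair_comm]; exact h.2⟩
        simp only [c', if_pos h, if_pos h', ext, LinearMap.coe_mk, AddHom.coe_mk]
        have := hor v w h.1 h.2
        by_cases h1 : (v, w) ∈ E
        · have h2 := this.1 h1
          simp [h1, h2]
        · have h2 : (w, v) ∈ E := by_contra fun h2 => h1 (this.2 h2)
          simp [h1, h2]
      · have h' : ¬ (w ≠ v ∧ {w, v} ∈ Δ.faces) := fun h' =>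
          h ⟨h'.1.symm, by rw [Finset.pair_comm]; exact h'.2⟩
        simp only [c', if_neg h, if_neg h', neg_zero]
    obtain ⟨g, hg⟩ := exists_rat_potential hfin hpure hcontr (c := c') hanti (by
      intro v w u hT
      have hs := hc0 ⟨_, hT.mem_triangles⟩
      have hts := ht ⟨_, hT.mem_triangles⟩
      set a := (t ⟨_, hT.mem_triangles⟩).1
      set b := (t ⟨_, hT.mem_triangles⟩).2.1
      set d := (t ⟨_, hT.mem_triangles⟩).2.2
      simp only at hts
      have hT' : IsTri Δ a b d := isTri_of_mem_triangles (by rw [← hts]; exact hT.mem_triangles)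
      have e1 : ext c a b = c' a b := by simp only [c', if_pos (And.intro hT'.ne₁₂ hT'.pair_mem)]
      have e2 : ext c b d = c' b d := by
        have := hT'.swap_left.swap.pair_mem
        simp only [c', if_pos (And.intro hT'.ne₂₃ this)]
      have e3 : ext c d a = c' d a := by
        have := hT'.swap.swap_left.pair_mem
        simp only [c', if_pos (And.intro hT'.ne₁₃.symm this)]
      rw [e1, e2, e3] at hs
      have hv : v ∈ ({a, b, d} : Finset Plane) := by rw [← hts]; simp
      have hw : w ∈ ({a, b, d} : Finset Plane) := by rw [← hts]; simp
      have hu : u ∈ ({a, b, d} : Finset Plane) := by rw [← hts]; simp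
      have n1 := hT.ne₁₂
      have n2 := hT.ne₁₃
      have n3 := hT.ne₂₃
      have q1 := hanti a b
      have q2 := hanti b d
      have q3 := hanti d a
      clear_value a b d
      simp only [Finset.mem_insert, Finset.mem_singleton] at hv hw hu
      rcases hv with rfl | rfl | rfl <;> rcases hw with rfl | rfl | rfl <;>
        rcases hu with rfl | rfl | rfl <;> first | contradiction | linarith)
    refine ⟨fun x => g x, ?_⟩
    ext e
    change g e.1.2 - g e.1.1 = c e
    have hne := (hE e e.2).1
    rw [← hg _ _ (hE e e.2).2]
    simp only [c', if_pos (And.intro hne (hE e e.2).2), ext, LinearMap.coe_mk, AddHom.coe_mk]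
    simp
  obtain ⟨v₀, hv₀⟩ : (verts hfin).Nonempty := by
    obtain ⟨⟨x, hx⟩⟩ : Nonempty Δ.space := inferInstance
    obtain ⟨s, hs, -⟩ := Δ.mem_space_iff.1 hx
    obtain ⟨y, hy⟩ := Δ.nonempty_of_mem_faces hs
    exact ⟨y, mem_verts_of_mem hs hy⟩
  -- The constants lie in the kernel of `δ₀`; this is the `1` in the inequality.
  have hone : 1 ≤ Module.finrank ℚ (LinearMap.ker δ₀) := by
    have h1 : (fun _ => 1 : verts hfin → ℚ) ∈ LinearMap.ker δ₀ := by
      rw [LinearMap.mem_ker]; ext e; simp [δ₀]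
    have : Nontrivial (LinearMap.ker δ₀) :=
      ⟨⟨_, h1⟩, 0, fun h => one_ne_zero (congrFun (congrArg Subtype.val h) ⟨v₀, hv₀⟩)⟩
    exact Module.finrank_pos
  have r0 := δ₀.finrank_range_add_finrank_ker
  have r1 := δ₁.finrank_range_add_finrank_ker
  have r2 := Submodule.finrank_mono hker
  have r3 := Submodule.finrank_le (LinearMap.range δ₁)
  rw [Module.finrank_fintype_fun_eq_card] at r0 r1 r3
  rw [Fintype.card_coe] at r0 r1
  rw [← Nat.card_coe_set_eq, Nat.card_eq_fintype_card]
  omega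

end Euler

/-! ### Polynomials of bounded degree and the dimension bound at a vertex. -/

section Polynomials

open MvPolynomial

/-- Real polynomials in the two coordinates of the plane. -/
abbrev Poly : Type := MvPolynomial (Fin 2) ℝ

/-- The pairs of natural numbers with sum less than `m`. -/
def pairsLT (m : ℕ) : Finset (ℕ × ℕ) := (Finset.range m).biUnion Finset.HasAntidiagonal.antidiagonal

lemma mem_pairsLT {m : ℕ} {e : ℕ × ℕ} : e ∈ pairsLT m ↔ e.1 + e.2 < m := by
  simp [pairsLT]

lemma card_pairsLT (m : ℕ) : (pairsLT m).card = (m + 1).choose 2 := by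
  rw [pairsLT, Finset.card_biUnion]
  · simp only [Finset.Nat.card_antidiagonal]
    induction m with
    | zero => rfl
    | succ n ih =>
      rw [Finset.sum_range_succ, ih, Nat.choose_succ_succ' (n + 1) 1, Nat.choose_one_right]
      ring
  · intro a _ b _ hab
    refine Finset.disjoint_left.2 fun e h1 h2 => hab ?_
    rw [Finset.HasAntidiagonal.mem_antidiagonal] at h1 h2
    rw [← h1, ← h2]

/-- The polynomials of total degree less than `m`. -/
def polyLT (m : ℕ) : Submodule ℝ Poly := restrictSupport ℝ {n | n 0 + n 1 < m}

lemma totalDegree_le_iff {p : Poly} {k : ℕ} : p.totalDegree ≤ k ↔ p ∈ polyLT (k + 1) := by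
  have : polyLT (k + 1) = restrictTotalDegree (Fin 2) ℝ k := by
    unfold polyLT restrictTotalDegree
    congr 1
    ext n
    simp [Finsupp.sum_fintype]
  rw [this, mem_restrictTotalDegree]

lemma polyLT_mono {a b : ℕ} (h : a ≤ b) : polyLT a ≤ polyLT b :=
  restrictSupport_mono ℝ fun _ hn => lt_of_lt_of_le hn h

/-- The exponents of degree less than `m`, as pairs. -/
def exponentEquiv (m : ℕ) : pairsLT m ≃ {n : Fin 2 →₀ ℕ | n 0 + n 1 < m} where
  toFun e := ⟨Finsupp.equivFunOnFinite.symm ![e.1.1, e.1.2], by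
    have := mem_pairsLT.1 e.2
    simpa using this⟩
  invFun n := ⟨(n.1 0, n.1 1), mem_pairsLT.2 n.2⟩
  left_inv e := by simp
  right_inv n := by
    ext i
    fin_cases i <;> simp

/-- A basis of the space of polynomials of degree less than `m`. -/
def polyLTBasis (m : ℕ) : Module.Basis (pairsLT m) ℝ (polyLT m) :=
  (basisRestrictSupport ℝ _).reindex (exponentEquiv m).symm

instance (m : ℕ) : FiniteDimensional ℝ (polyLT m) := (polyLTBasis m).finiteDimensional_of_finite

lemma finrank_polyLT (m : ℕ) : Module.finrank ℝ (polyLT m) = (m + 1).choose 2 := by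
  rw [Module.finrank_eq_card_basis (polyLTBasis m), Fintype.card_coe, card_pairsLT]

open scoped Pointwise in
lemma mul_mem_polyLT {a b : ℕ} {p q : Poly} (hp : p ∈ polyLT (a + 1)) (hq : q ∈ polyLT b) :
    p * q ∈ polyLT (a + b) := by
  have h := Submodule.mul_mem_mul hp hq
  unfold polyLT at h
  rw [← restrictSupport_add] at h
  refine restrictSupport_mono ℝ ?_ h
  rintro _ ⟨x, hx, y, hy, rfl⟩
  simp only [Set.mem_ofPred_eq, Finsupp.add_apply] at hx hy ⊢
  omega

/-- The linear polynomial vanishing on the line through `v` in direction `d`. -/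
def line (v d : Plane) : Poly := C (d 0) * (X 1 - C (v 1)) - C (d 1) * (X 0 - C (v 0))

/-- The function on the plane defined by a polynomial. -/
def fn (p : Poly) (x : Plane) : ℝ := eval (fun i => x i) p

lemma fn_line (v d x : Plane) : fn (line v d) x = det2 d (x - v) := by
  simp [fn, line, det2]

lemma line_smul (v d : Plane) (t : ℝ) : line v (t • d) = C t * line v d := by
  simp [line]; ring

lemma line_swap (v w : Plane) : line w (v - w) = -line v (w - v) := by
  simp [line]; ring

lemma line_ne_zero {v d : Plane} (hd : d ≠ 0) : line v d ≠ 0 := by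
  intro h
  have h1 : ∀ x, det2 d (x - v) = 0 := fun x => by rw [← fn_line, h]; simp [fn]
  have e0 := h1 (v + !₂[1, 0])
  have e1 := h1 (v + !₂[0, 1])
  simp [det2] at e0 e1
  apply hd
  ext i
  fin_cases i <;> simp [e0, e1]

lemma line_mem_polyLT (v d : Plane) : line v d ∈ polyLT 2 := by
  rw [← totalDegree_le_iff]
  have h : ∀ (a b : ℝ) (i : Fin 2), (C a * (X i - C b) : Poly).totalDegree ≤ 1 := fun a b i => by
    refine (totalDegree_mul _ _).trans ?_
    rw [totalDegree_C, zero_add]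
    refine (totalDegree_sub _ _).trans ?_
    simp
  exact (totalDegree_sub _ _).trans (max_le (h _ _ _) (h _ _ _))

lemma line_pow_mul_mem_polyLT (v d : Plane) (n : ℕ) {m : ℕ} {q : Poly} (hq : q ∈ polyLT m) :
    line v d ^ n * q ∈ polyLT (n + m) := by
  induction n with
  | zero => simpa using hq
  | succ n ih =>
    rw [pow_succ', mul_assoc, show n + 1 + m = 1 + (n + m) by ring]
    exact mul_mem_polyLT (line_mem_polyLT v d) ih

/-- The span of the monomials centred at `v` whose degree lies in `S`. -/
def centredSpan (v : Plane) (S : Set ℕ) : Submodule ℝ Poly :=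
  Submodule.span ℝ ((fun e : ℕ × ℕ => (X 0 - C (v 0)) ^ e.1 * (X 1 - C (v 1)) ^ e.2) ''
    {e | e.1 + e.2 ∈ S})

lemma centredSpan_mono (v : Plane) {S T : Set ℕ} (h : S ⊆ T) :
    centredSpan v S ≤ centredSpan v T :=
  Submodule.span_mono (Set.image_mono fun _ he => h he)

lemma mem_centredSpan (v : Plane) {S : Set ℕ} {a b : ℕ} (h : a + b ∈ S) :
    ((X 0 - C (v 0)) ^ a * (X 1 - C (v 1)) ^ b : Poly) ∈ centredSpan v S :=
  Submodule.subset_span ⟨(a, b), h, rfl⟩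

lemma mul_mem_centredSpan (v : Plane) {S T : Set ℕ} {l p : Poly}
    (hl : ∀ a b : ℕ, a + b ∈ S →
      l * ((X 0 - C (v 0)) ^ a * (X 1 - C (v 1)) ^ b) ∈ centredSpan v T)
    (hp : p ∈ centredSpan v S) : l * p ∈ centredSpan v T := by
  induction hp using Submodule.span_induction with
  | mem x hx =>
    obtain ⟨e, he, rfl⟩ := hx
    exact hl _ _ he
  | zero => rw [mul_zero]; exact zero_mem _
  | add x y _ _ hx hy => rw [mul_add]; exact add_mem hx hy
  | smul c x _ hx => rw [mul_smul_comm]; exact Submodule.smul_mem _ _ hx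

lemma line_mul_mem_centredSpan (v d : Plane) {S T : Set ℕ} (hST : ∀ n ∈ S, n + 1 ∈ T) {p : Poly}
    (hp : p ∈ centredSpan v S) : line v d * p ∈ centredSpan v T := by
  refine mul_mem_centredSpan v (fun a b hab => ?_) hp
  have : (line v d * ((X 0 - C (v 0)) ^ a * (X 1 - C (v 1)) ^ b) : Poly) =
      d 0 • ((X 0 - C (v 0)) ^ a * (X 1 - C (v 1)) ^ (b + 1)) -
        d 1 • ((X 0 - C (v 0)) ^ (a + 1) * (X 1 - C (v 1)) ^ b) := by
    rw [smul_eq_C_mul, smul_eq_C_mul, line]; ring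
  rw [this]
  refine sub_mem (Submodule.smul_mem _ _ (mem_centredSpan v ?_))
    (Submodule.smul_mem _ _ (mem_centredSpan v ?_))
  · exact hST _ hab
  · have := hST _ hab
    rwa [add_right_comm] at this

lemma line_pow_mul_mem_centredSpan (v d : Plane) (n a b : ℕ) {p : Poly}
    (hp : p ∈ centredSpan v (Set.Ico a b)) :
    line v d ^ n * p ∈ centredSpan v (Set.Ico (a + n) (b + n)) := by
  induction n with
  | zero => simpa using hp
  | succ n ih =>
    rw [pow_succ', mul_assoc]
    refine line_mul_mem_centredSpan v d (fun m hm => ?_) ih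
    rw [Set.mem_Ico] at hm ⊢
    omega

lemma X_mul_mem_centredSpan (v : Plane) (i : Fin 2) {m : ℕ} {p : Poly}
    (hp : p ∈ centredSpan v (Set.Iio m)) : X i * p ∈ centredSpan v (Set.Iio (m + 1)) := by
  refine mul_mem_centredSpan v (fun a b hab => ?_) hp
  have hab' : a + b < m := hab
  have h0 := mem_centredSpan v (S := Set.Iio (m + 1)) (a := a) (b := b)
    (by rw [Set.mem_Iio]; omega)
  fin_cases i
  · have : (X 0 * ((X 0 - C (v 0)) ^ a * (X 1 - C (v 1)) ^ b) : Poly) =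
        (X 0 - C (v 0)) ^ (a + 1) * (X 1 - C (v 1)) ^ b +
          v 0 • ((X 0 - C (v 0)) ^ a * (X 1 - C (v 1)) ^ b) := by
      rw [smul_eq_C_mul]; ring
    simp only [Fin.zero_eta, Fin.isValue]
    rw [this]
    exact add_mem (mem_centredSpan v (by rw [Set.mem_Iio]; omega)) (Submodule.smul_mem _ _ h0)
  · have : (X 1 * ((X 0 - C (v 0)) ^ a * (X 1 - C (v 1)) ^ b) : Poly) =
        (X 0 - C (v 0)) ^ a * (X 1 - C (v 1)) ^ (b + 1) +
          v 1 • ((X 0 - C (v 0)) ^ a * (X 1 - C (v 1)) ^ b) := by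
      rw [smul_eq_C_mul]; ring
    simp only [Fin.mk_one, Fin.isValue]
    rw [this]
    exact add_mem (mem_centredSpan v (by rw [Set.mem_Iio]; omega)) (Submodule.smul_mem _ _ h0)

/-- Re-expanding about `v` does not raise the degree: multiplying by a coordinate raises the centred
degree by at most one. -/
lemma polyLT_le_centredSpan (v : Plane) (m : ℕ) : polyLT m ≤ centredSpan v (Set.Iio m) := by
  have key : ∀ a b : ℕ, (X 0 ^ a * X 1 ^ b : Poly) ∈ centredSpan v (Set.Iio (a + b + 1)) := by
    intro a
    induction a with
    | zero =>
      intro b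
      induction b with
      | zero =>
        have := mem_centredSpan v (S := Set.Iio 1) (a := 0) (b := 0) (by simp)
        simpa using this
      | succ b ih =>
        have := X_mul_mem_centredSpan v 1 ih
        simp only [pow_zero, one_mul, zero_add] at this ⊢
        rwa [← pow_succ'] at this
    | succ a ih =>
      intro b
      have := X_mul_mem_centredSpan v 0 (ih b)
      rw [← mul_assoc, ← pow_succ'] at this
      rwa [show a + 1 + b + 1 = a + b + 1 + 1 by ring]
  unfold polyLT
  rw [restrictSupport_eq_span, Submodule.span_le]
  rintro _ ⟨n, hn, rfl⟩
  have hn' : n 0 + n 1 < m := hn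
  have hmon : (monomial n (1 : ℝ) : Poly) = X 0 ^ n 0 * X 1 ^ n 1 := by
    rw [monomial_eq, Finsupp.prod_fintype _ _ (by simp)]
    simp
  simp only [SetLike.mem_coe]
  rw [hmon]
  exact centredSpan_mono v (Set.Iio_subset_Iio (by omega)) (key _ _)

lemma centredSpan_Ico_eq (v : Plane) (a b : ℕ) :
    centredSpan v (Set.Ico a b) = Submodule.span ℝ
      (((pairsLT b \ pairsLT a).image fun e : ℕ × ℕ =>
        ((X 0 - C (v 0)) ^ e.1 * (X 1 - C (v 1)) ^ e.2 : Poly) : Finset Poly) : Set Poly) := by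
  unfold centredSpan
  congr 1
  ext p
  simp only [Set.mem_image, Set.mem_ofPred_eq, Set.mem_Ico, Finset.coe_image, Finset.coe_sdiff,
    Set.mem_sdiff, Finset.mem_coe, mem_pairsLT, not_lt]
  constructor <;> rintro ⟨e, ⟨h1, h2⟩, rfl⟩ <;> exact ⟨e, ⟨h2, h1⟩, rfl⟩

instance (v : Plane) (a b : ℕ) : FiniteDimensional ℝ (centredSpan v (Set.Ico a b)) := by
  rw [centredSpan_Ico_eq]
  exact FiniteDimensional.span_finset ℝ _

lemma finrank_centredSpan_le (v : Plane) {a b : ℕ} (hab : a ≤ b) :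
    Module.finrank ℝ (centredSpan v (Set.Ico a b)) + (a + 1).choose 2 ≤ (b + 1).choose 2 := by
  rw [centredSpan_Ico_eq]
  have h1 := (finrank_span_finset_le_card (R := ℝ)
    ((pairsLT b \ pairsLT a).image fun e : ℕ × ℕ =>
        ((X 0 - C (v 0)) ^ e.1 * (X 1 - C (v 1)) ^ e.2 : Poly))).trans Finset.card_image_le
  have hsub : pairsLT a ⊆ pairsLT b := fun e he => by
    rw [mem_pairsLT] at he ⊢; omega
  rw [Finset.card_sdiff_of_subset hsub, card_pairsLT, card_pairsLT] at h1
  have h2 := Finset.card_le_card hsub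
  rw [card_pairsLT, card_pairsLT] at h2
  unfold Set.finrank at h1
  omega

lemma finrank_finset_sup_le {ι V : Type*} [AddCommGroup V] [Module ℝ V] (s : Finset ι)
    (p : ι → Submodule ℝ V) [∀ i, FiniteDimensional ℝ (p i)] {n : ℕ}
    (h : ∀ i, Module.finrank ℝ (p i) ≤ n) : Module.finrank ℝ (s.sup p : Submodule ℝ V) ≤ s.card * n := by
  induction s using Finset.induction_on with
  | empty => simp
  | insert a s ha ih =>
    rw [Finset.sup_insert, Finset.card_insert_of_notMem ha, add_mul, one_mul, add_comm]
    exact (Submodule.finrank_add_le_finrank_add_finrank _ _).trans (add_le_add (h a) ih)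

/-- The multiples of the `n`-th power of the line through `v` in direction `d`, with cofactors
of degree less than `m`. -/
def lineMul (v d : Plane) (n m : ℕ) : Submodule ℝ Poly :=
  (polyLT m).map (LinearMap.mulLeft ℝ (line v d ^ n))

instance (v d : Plane) (n m : ℕ) : FiniteDimensional ℝ (lineMul v d n m) := by
  unfold lineMul; infer_instance

lemma lineMul_smul_le (v d : Plane) (t : ℝ) (n m : ℕ) :
    lineMul v (t • d) n m ≤ lineMul v d n m := by
  rintro _ ⟨q, hq, rfl⟩
  refine ⟨t ^ n • q, Submodule.smul_mem _ _ hq, ?_⟩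
  simp only [LinearMap.mulLeft_apply, line_smul, smul_eq_C_mul, map_pow]
  ring

lemma finrank_sup_lineMul_le {ι : Type*} (s : Finset ι) (v : Plane) (d : ι → Plane) (n m : ℕ) :
    Module.finrank ℝ (s.sup fun i => lineMul v (d i) n m : Submodule ℝ Poly) ≤
      s.card * (m + 1).choose 2 :=
  finrank_finset_sup_le s _ fun _ => (Submodule.finrank_map_le _ _).trans (finrank_polyLT m).le

/-- A line through `v` is homogeneous of degree one in coordinates centred at `v`. Split each
cofactor at centred degree `c`: the low parts contribute at most one cofactor space per line, and
all products with high parts lie in the single space of centred degrees in `[c + n, m + n)`. -/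
lemma finrank_sup_lineMul_add_le {ι : Type*} (s : Finset ι) (v : Plane) (d : ι → Plane)
    (n : ℕ) {c m : ℕ} (hcm : c ≤ m) :
    Module.finrank ℝ (s.sup fun i => lineMul v (d i) n m : Submodule ℝ Poly) +
      (c + n + 1).choose 2 ≤ s.card * (c + 1).choose 2 + (m + n + 1).choose 2 := by
  set A : ι → Submodule ℝ Poly := fun i =>
    (centredSpan v (Set.Ico 0 c)).map (LinearMap.mulLeft ℝ (line v (d i) ^ n)) with hA
  have hAfin : ∀ i, FiniteDimensional ℝ (A i) := fun i => by rw [hA]; infer_instance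
  have hle : (s.sup fun i => lineMul v (d i) n m) ≤
      s.sup A ⊔ centredSpan v (Set.Ico (c + n) (m + n)) := by
    refine Finset.sup_le fun i hi => ?_
    rintro _ ⟨q, hq, rfl⟩
    have hq' : q ∈ centredSpan v (Set.Ico 0 c) ⊔ centredSpan v (Set.Ico c m) := by
      refine (polyLT_le_centredSpan v m).trans ?_ hq
      unfold centredSpan
      rw [← Submodule.span_union, ← Set.image_union]
      refine Submodule.span_mono (Set.image_mono fun e he => ?_)
      have he' : e.1 + e.2 < m := he
      by_cases h : e.1 + e.2 < c
      · exact Or.inl ⟨Nat.zero_le _, h⟩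
      · exact Or.inr ⟨not_lt.1 h, he'⟩
    obtain ⟨q₁, h₁, q₂, h₂, rfl⟩ := Submodule.mem_sup.1 hq'
    rw [map_add]
    refine add_mem (Submodule.mem_sup_left (Finset.le_sup (f := A) hi ⟨q₁, h₁, rfl⟩))
      (Submodule.mem_sup_right (line_pow_mul_mem_centredSpan v (d i) n c m h₂))
  have h1 := (Submodule.finrank_mono hle).trans
    (Submodule.finrank_add_le_finrank_add_finrank _ _)
  have h2 := finrank_centredSpan_le v (Nat.add_le_add_right hcm n)
  have h3 := finrank_finset_sup_le s A (n := (c + 1).choose 2) fun _ => by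
    have := finrank_centredSpan_le v (Nat.zero_le c)
    exact (Submodule.finrank_map_le _ _).trans (by omega)
  omega

lemma choose_two_cast (n : ℕ) : (2 : ℤ) * (n.choose 2 : ℤ) = n * (n - 1) := by
  induction n with
  | zero => simp
  | succ n ih =>
    rw [Nat.choose_succ_succ' n 1, Nat.choose_one_right]
    push_cast
    linear_combination ih

lemma lt_Omega {t : ℕ} (ht : 2 ≤ t) (r : ℕ) : r + 1 ≤ Omega t r := by
  unfold Omega
  refine Nat.succ_le_succ ((Nat.le_div_iff_mul_le (by omega)).2 ?_)
  rw [mul_comm t r]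
  exact Nat.mul_le_mul_left _ (by omega)

/-- The dimension bound at an interior vertex, in closed form. -/
lemma le_vertex_bound {t r k d : ℕ} (ht : 2 ≤ t) (h1 : d ≤ t * (k - r + 1).choose 2)
    (h2 : ∀ c, c ≤ k - r → d + (c + (r + 1) + 1).choose 2 ≤
      t * (c + 1).choose 2 + (k - r + (r + 1) + 1).choose 2) :
    (d : ℤ) ≤ (t : ℤ) * ((k + 2 - (r + 1)).choose 2 : ℤ)
      - bMult t r * ((k + 2 - Omega t r).choose 2 : ℤ)
      - aMult t r * ((k + 2 - (Omega t r + 1)).choose 2 : ℤ) := by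
  -- The cutoff is `c = m`, so `c + (r + 1) = Omega t r`, the least degree `j` with `t (j - r) ≥ j +
  -- 1`, where the `t` lines offer enough generators to fill all forms of degree `j`.
  obtain ⟨m, hm⟩ := Nat.exists_eq_add_of_le (lt_Omega ht r)
  unfold bMult aMult
  rw [hm]
  -- Here the cutoff exceeds the available degrees; the corrections vanish and counting generators
  -- suffices.
  by_cases hk : k < r + m
  · rw [Nat.choose_eq_zero_of_lt (show k + 2 - (r + 1 + m) < 2 by omega),
      Nat.choose_eq_zero_of_lt (show k + 2 - (r + 1 + m + 1) < 2 by omega)]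
    have : (k - r + 1).choose 2 ≤ (k + 2 - (r + 1)).choose 2 := by
      by_cases hkr : r ≤ k
      · rw [show k + 2 - (r + 1) = k - r + 1 by omega]
      · rw [show k - r = 0 by omega]; simp
    have h3 := h1.trans (Nat.mul_le_mul_left t this)
    have : (d : ℤ) ≤ t * ((k + 2 - (r + 1)).choose 2 : ℤ) := by exact_mod_cast h3
    simpa using this
  · obtain ⟨s, rfl⟩ := Nat.exists_eq_add_of_le (not_lt.1 hk)
    have h3 := h2 m (by omega)
    rw [show r + m + s - r + (r + 1) + 1 = r + m + s + 2 by omega] at h3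
    rw [show r + m + s + 2 - (r + 1) = m + s + 1 by omega,
      show r + m + s + 2 - (r + 1 + m) = s + 1 by omega,
      show r + m + s + 2 - (r + 1 + m + 1) = s by omega]
    have h4 : (d : ℤ) + ((m + (r + 1) + 1).choose 2 : ℤ) ≤
        t * ((m + 1).choose 2 : ℤ) + ((r + m + s + 2).choose 2 : ℤ) := by exact_mod_cast h3
    have c1 := choose_two_cast (m + (r + 1) + 1)
    have c2 := choose_two_cast (m + 1)
    have c3 := choose_two_cast (r + m + s + 2)
    have c4 := choose_two_cast (m + s + 1)
    have c5 := choose_two_cast (s + 1)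
    have c6 := choose_two_cast s
    push_cast at *
    set C1 : ℤ := ((m + (r + 1) + 1).choose 2 : ℤ)
    set C2 : ℤ := ((m + 1).choose 2 : ℤ)
    set C3 : ℤ := ((r + m + s + 2).choose 2 : ℤ)
    set C4 : ℤ := ((m + s + 1).choose 2 : ℤ)
    set C5 : ℤ := ((s + 1).choose 2 : ℤ)
    set C6 : ℤ := (s.choose 2 : ℤ)
    have key : 2 * ((t : ℤ) * C2 + C3 - C1) = 2 * (t * C4 -
        (t - 1 - (t * (r + 1) + (1 - t) * (r + 1 + m))) * C5 -
        (t * (r + 1) + (1 - t) * (r + 1 + m)) * C6) := by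
      linear_combination (t : ℤ) * c2 + c3 - c1 - t * c4 +
        (t - 1 - (t * (r + 1) + (1 - t) * (r + 1 + m)) : ℤ) * c5 +
        (t * (r + 1) + (1 - t) * (r + 1 + m) : ℤ) * c6
    linarith

end Polynomials

/-! ### Jets of polynomials and smooth gluing. -/

section Smoothness

open MvPolynomial

lemma fn_add (p q : Poly) (x : Plane) : fn (p + q) x = fn p x + fn q x := by simp [fn]

lemma contDiff_fn (p : Poly) {n : WithTop ℕ∞} : ContDiff ℝ n (fn p) := by
  induction p using MvPolynomial.induction_on with
  | C a =>
    have : fn (C a) = fun _ => a := by ext x; simp [fn]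
    rw [this]; exact contDiff_const
  | add p q hp hq =>
    have : fn (p + q) = fun x => fn p x + fn q x := by ext x; exact fn_add p q x
    rw [this]; exact hp.add hq
  | mul_X p i hp =>
    have : fn (p * X i) = fun x => fn p x * x i := by ext x; simp [fn]
    rw [this]
    exact hp.mul (by fun_prop)

lemma iteratedFDeriv_mul_eq_zero {f g : Plane → ℝ} (hf : ContDiff ℝ ⊤ f) (hg : ContDiff ℝ ⊤ g)
    {x : Plane} {n : ℕ} (h : ∀ m < n, iteratedFDeriv ℝ m f x = 0) :
    ∀ m < n, iteratedFDeriv ℝ m (fun y => f y * g y) x = 0 := by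
  intro m hm
  have := norm_iteratedFDeriv_mul_le (n := m) hf hg x le_top
  rw [Finset.sum_eq_zero] at this
  · exact norm_le_zero_iff.1 this
  · intro i hi
    rw [h i (by rw [Finset.mem_range] at hi; omega), norm_zero, mul_zero, zero_mul]

/-- In the Leibniz bound for `g ^ n * g`, each term has either a derivative of `g ^ n` of order
below `n` or the undifferentiated factor `g x = 0`. -/
lemma iteratedFDeriv_pow_eq_zero {g : Plane → ℝ} (hg : ContDiff ℝ ⊤ g) {x : Plane}
    (hx : g x = 0) (n : ℕ) : ∀ m < n, iteratedFDeriv ℝ m (fun y => g y ^ n) x = 0 := by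
  induction n with
  | zero => intro m hm; omega
  | succ n ih =>
    intro m hm
    have := norm_iteratedFDeriv_mul_le (n := m) (hg.pow n) hg x le_top
    rw [Finset.sum_eq_zero] at this
    · simp only [pow_succ]
      exact norm_le_zero_iff.1 this
    · intro i hi
      by_cases hin : i < n
      · rw [ih i hin, norm_zero, mul_zero, zero_mul]
      · rw [Finset.mem_range] at hi
        rw [show m - i = 0 by omega, norm_iteratedFDeriv_zero, hx, norm_zero, mul_zero]

/-- The derivatives up to order `r` of two polynomials agree at `x`. -/
def JetEq (r : ℕ) (x : Plane) (p q : Poly) : Prop :=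
  ∀ m ≤ r, iteratedFDeriv ℝ m (fn p) x = iteratedFDeriv ℝ m (fn q) x

lemma JetEq.refl (r : ℕ) (x : Plane) (p : Poly) : JetEq r x p p := fun _ _ => rfl

lemma JetEq.symm {r : ℕ} {x : Plane} {p q : Poly} (h : JetEq r x p q) : JetEq r x q p :=
  fun m hm => (h m hm).symm

lemma JetEq.trans {r : ℕ} {x : Plane} {p q s : Poly} (h : JetEq r x p q) (h' : JetEq r x q s) :
    JetEq r x p s := fun m hm => (h m hm).trans (h' m hm)

lemma JetEq.fn_eq {r : ℕ} {x : Plane} {p q : Poly} (h : JetEq r x p q) : fn p x = fn q x := by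
  have := h 0 (Nat.zero_le r)
  have h2 := congrArg (fun f => f 0) this
  simpa using h2

lemma jetEq_of_line {r : ℕ} {v d x : Plane} {p q c : Poly} (hx : det2 d (x - v) = 0)
    (h : p = q + line v d ^ (r + 1) * c) : JetEq r x p q := by
  intro m hm
  have h1 : fn p = fn q + fun y => fn (line v d) y ^ (r + 1) * fn c y := by
    ext y
    rw [h]
    simp [fn]
  rw [h1, iteratedFDeriv_add_apply ((contDiff_fn q).contDiffAt)
    ((((contDiff_fn _).pow _).mul (contDiff_fn c)).contDiffAt)]
  rw [iteratedFDeriv_mul_eq_zero ((contDiff_fn _).pow _) (contDiff_fn c)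
    (iteratedFDeriv_pow_eq_zero (contDiff_fn _) (by rw [fn_line, hx]) _) m (by omega), add_zero]

/-- A polynomial vanishing on a triangle is zero. -/
lemma eq_zero_of_fn_eq_zero {v w u : Plane} (hne : orient v w u ≠ 0) {p : Poly}
    (h : ∀ x ∈ convexHull ℝ (({v, w, u} : Finset Plane) : Set Plane), fn p x = 0) : p = 0 := by
  set U : Set (Fin 2 → ℝ) := {y | 0 < det2 (WithLp.toLp 2 y - v) (u - v) / orient v w u ∧
    0 < det2 (w - v) (WithLp.toLp 2 y - v) / orient v w u ∧
    det2 (WithLp.toLp 2 y - v) (u - v) / orient v w u +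
      det2 (w - v) (WithLp.toLp 2 y - v) / orient v w u < 1} with hU
  have hc1 : Continuous fun y : Fin 2 → ℝ =>
      det2 (WithLp.toLp 2 y - v) (u - v) / orient v w u := by
    unfold det2; fun_prop
  have hc2 : Continuous fun y : Fin 2 → ℝ =>
      det2 (w - v) (WithLp.toLp 2 y - v) / orient v w u := by
    unfold det2; fun_prop
  have hopen : IsOpen U :=
    (isOpen_lt continuous_const hc1).inter ((isOpen_lt continuous_const hc2).inter
      (isOpen_lt (hc1.add hc2) continuous_const))
  -- An interior point of the triangle: a box around it is a product of infinite sets on which `p`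
  -- vanishes.
  set c : Plane := v + ((1 / 4 : ℝ) • (w - v) + (1 / 4 : ℝ) • (u - v)) with hc
  have hcU : c.ofLp ∈ U := by
    have e1 : det2 (c - v) (u - v) / orient v w u = 1 / 4 := by
      rw [hc, add_sub_cancel_left, det2_add_left, det2_smul_left, det2_smul_left, det2_self]
      change (1 / 4 * orient v w u + 1 / 4 * 0) / _ = _
      field_simp; ring
    have e2 : det2 (w - v) (c - v) / orient v w u = 1 / 4 := by
      rw [hc, add_sub_cancel_left, det2_add_right, det2_smul_right, det2_smul_right, det2_self]
      change (1 / 4 * 0 + 1 / 4 * orient v w u) / _ = _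
      field_simp; ring
    simp only [hU, Set.mem_ofPred_eq, WithLp.toLp_ofLp, e1, e2]
    norm_num
  obtain ⟨ε, hε, hball⟩ := Metric.isOpen_iff.1 hopen _ hcU
  rw [ball_pi _ hε] at hball
  refine MvPolynomial.funext_set (fun i => Metric.ball (c.ofLp i) ε) (fun i => ?_) fun x hx => ?_
  · rw [Real.ball_eq_Ioo]
    exact Set.Ioo_infinite (by linarith)
  · obtain ⟨h1, h2, h3⟩ := hball hx
    have := h (WithLp.toLp 2 x) (mem_convexHull_triple.2 ⟨_, _, h1.le, h2.le, h3.le, ?_⟩)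
    · simpa [fn] using this
    · have := eq_smul_add_smul_of_det2_ne_zero (A := w - v) (B := u - v) hne (WithLp.toLp 2 x - v)
      exact (eq_add_of_sub_eq' this)

variable {Δ : SimplicialComplex ℝ Plane}

/-- Polynomials on the triangles whose jets agree at all common points glue to a function of
class `C^r`. -/
theorem exists_contDiffOn_glue (hfin : Δ.faces.Finite) (hpure : IsPure Δ) (r : ℕ)
    (p : triangles Δ → Poly)
    (h : ∀ s t : triangles Δ, ∀ x : Plane,
      x ∈ convexHull ℝ ((s : Finset Plane) : Set Plane) →
      x ∈ convexHull ℝ ((t : Finset Plane) : Set Plane) → JetEq r x (p s) (p t)) :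
    ∃ F : Plane → ℝ, ContDiffOn ℝ (r : WithTop ℕ∞) F Δ.space ∧
      ∀ s : triangles Δ, ∀ x ∈ convexHull ℝ ((s : Finset Plane) : Set Plane),
        F x = fn (p s) x := by
  choose τ hτ using exists_triangle_of_mem_space hpure
  let D : Plane → FormalMultilinearSeries ℝ Plane ℝ := fun x m =>
    if hx : x ∈ Δ.space then iteratedFDeriv ℝ m (fn (p (τ ⟨x, hx⟩))) x else 0
  have hD : ∀ s : triangles Δ, ∀ x ∈ convexHull ℝ ((s : Finset Plane) : Set Plane),
      ∀ m ≤ r, D x m = iteratedFDeriv ℝ m (fn (p s)) x := by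
    intro s x hx m hm
    have hxs : x ∈ Δ.space := Δ.convexHull_subset_space s.2.1 hx
    simp only [D, dif_pos hxs]
    exact h _ _ x (hτ ⟨x, hxs⟩) hx m hm
  have hfinT : Finite (triangles Δ) := finite_triangles hfin
  have hT : HasFTaylorSeriesUpToOn (r : WithTop ℕ∞) (fun x => (D x 0).curry0) D Δ.space := by
    constructor
    · intro x _; rfl
    · intro m hm x hx
      have hm' : m < r := by exact_mod_cast hm
      -- Differentiability can be tested on each of the finitely many triangles. If `x` is outside a
      -- triangle, closedness makes the condition void; inside, `D` is the polynomial's own jet.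
      have key : ∀ s : triangles Δ, HasFDerivWithinAt (fun y => D y m) (D x m.succ).curryLeft
          (convexHull ℝ ((s : Finset Plane) : Set Plane)) x := by
        intro s
        by_cases hxs : x ∈ convexHull ℝ ((s : Finset Plane) : Set Plane)
        · rw [hD s x hxs _ hm']
          have h1 := ((contDiff_fn (p s) (n := (⊤ : ℕ∞))).ftaylorSeries).fderiv m
            (by exact_mod_cast WithTop.coe_lt_top m) x
          exact h1.hasFDerivWithinAt.congr (fun y hy => hD s y hy m hm'.le)
            (hD s x hxs m hm'.le)
        · refine HasFDerivWithinAt.of_notMem_closure ?_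
          rwa [(isClosed_convexHull_finset _).closure_eq]
      rw [space_eq_iUnion_triangles hpure]
      rw [hasFDerivWithinAt_iff_tendsto, nhdsWithin_iUnion, Filter.tendsto_iSup]
      exact fun s => hasFDerivWithinAt_iff_tendsto.1 (key s)
    · intro m hm
      have hm' : m ≤ r := by exact_mod_cast hm
      rw [space_eq_iUnion_triangles hpure]
      refine (locallyFinite_of_finite _).continuousOn_iUnion
        (fun s => isClosed_convexHull_finset s) fun s => ?_
      exact ((contDiff_fn (p s) (n := m)).continuous_iteratedFDeriv le_rfl).continuousOn.congr
        fun y hy => hD s y hy m hm'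
  refine ⟨_, hT.contDiffOn, fun s x hx => ?_⟩
  rw [hD s x hx 0 (Nat.zero_le r)]
  simp

end Smoothness

/-! ### The linear system of gluing conditions and the dimension of its kernel. -/

section GluingConditions

variable {Δ : SimplicialComplex ℝ Plane} {v w u : Plane}

/-- The lexicographic order of the plane. -/
def LexLT (v w : Plane) : Prop := v 0 < w 0 ∨ (v 0 = w 0 ∧ v 1 < w 1)

lemma lexLT_iff_not (h : v ≠ w) : LexLT v w ↔ ¬ LexLT w v := by
  unfold LexLT
  have : ¬ (v 0 = w 0 ∧ v 1 = w 1) := by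
    rintro ⟨h0, h1⟩
    apply h
    ext i
    fin_cases i
    · exact h0
    · exact h1
  grind

lemma LexLT.ne (h : LexLT v w) : v ≠ w := by
  rintro rfl
  simp [LexLT] at h

/-- The interior edges, oriented lexicographically. -/
def intEdges (hfin : Δ.faces.Finite) : Finset (Plane × Plane) :=
  (verts hfin ×ˢ verts hfin).filter fun e => {e.1, e.2} ∈ interiorEdges Δ ∧ LexLT e.1 e.2

/-- The boundary edges, oriented such that the complex lies to the left. -/
def bdryEdges (hfin : Δ.faces.Finite) : Finset (Plane × Plane) :=
  (verts hfin ×ˢ verts hfin).filter fun e => ∃ u, IsBdry Δ e.1 e.2 u ∧ 0 < orient e.1 e.2 u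

/-- The interior vertices. -/
def intVerts (hfin : Δ.faces.Finite) : Finset Plane :=
  (verts hfin).filter fun v => ¬ ∃ w u, IsBdry Δ v w u

/-- The boundary vertices. -/
def bdryVerts (hfin : Δ.faces.Finite) : Finset Plane :=
  (verts hfin).filter fun v => ∃ w u, IsBdry Δ v w u

variable {hfin : Δ.faces.Finite}

lemma pair_mem_interiorEdges_iff (hne : v ≠ w) :
    {v, w} ∈ interiorEdges Δ ↔ {v, w} ∈ Δ.faces ∧ ¬ ∃ u, IsBdry Δ v w u := by
  unfold interiorEdges
  rw [Set.mem_ofPred_eq, pair_mem_boundaryFaces_iff hne]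
  simp [Finset.card_pair hne]

lemma mem_intEdges : (v, w) ∈ intEdges hfin ↔
    LexLT v w ∧ {v, w} ∈ Δ.faces ∧ ¬ ∃ u, IsBdry Δ v w u := by
  simp only [intEdges, Finset.mem_filter, Finset.mem_product]
  constructor
  · rintro ⟨-, h1, h2⟩
    exact ⟨h2, (pair_mem_interiorEdges_iff h2.ne).1 h1⟩
  · rintro ⟨h1, h2⟩
    exact ⟨⟨mem_verts_of_mem h2.1 (by simp), mem_verts_of_mem h2.1 (by simp)⟩,
      (pair_mem_interiorEdges_iff h1.ne).2 h2, h1⟩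

lemma mem_bdryEdges : (v, w) ∈ bdryEdges hfin ↔ ∃ u, IsBdry Δ v w u ∧ 0 < orient v w u := by
  simp only [bdryEdges, Finset.mem_filter, Finset.mem_product, and_iff_right_iff_imp]
  rintro ⟨u, hB, -⟩
  exact ⟨mem_verts_of_mem hB.1.mem (by simp), mem_verts_of_mem hB.1.mem (by simp)⟩

lemma mem_intVerts : v ∈ intVerts hfin ↔ {v} ∈ Δ.faces ∧ ¬ ∃ w u, IsBdry Δ v w u := by
  rw [intVerts, Finset.mem_filter, mem_verts]

lemma mem_bdryVerts : v ∈ bdryVerts hfin ↔ ∃ w u, IsBdry Δ v w u := by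
  rw [bdryVerts, Finset.mem_filter, mem_verts, and_iff_right_iff_imp]
  rintro ⟨w, u, hB⟩
  exact hB.1.singleton_mem

lemma coe_intVerts : (intVerts hfin : Set Plane) = interiorVertices Δ := by
  ext v
  rw [Finset.mem_coe, mem_intVerts, interiorVertices, Set.mem_ofPred_eq,
    singleton_mem_boundaryFaces_iff]

lemma card_intEdges : (intEdges hfin).card = (interiorEdges Δ).ncard := by
  rw [← Set.ncard_coe_finset]
  refine Set.ncard_congr (fun e _ => {e.1, e.2}) ?_ ?_ ?_
  · rintro ⟨a, b⟩ h
    exact ((Finset.mem_filter.1 h).2).1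
  · rintro ⟨a, b⟩ ⟨a', b'⟩ h h' heq
    have h1 := (mem_intEdges.1 h).1
    have h2 := (mem_intEdges.1 h').1
    have h3 := (lexLT_iff_not h1.ne).1 h1
    have := congrArg (fun s : Finset Plane => (s : Set Plane)) heq
    simp only [Finset.coe_insert, Finset.coe_singleton, Set.pair_eq_pair_iff] at this
    rcases this with ⟨rfl, rfl⟩ | ⟨rfl, rfl⟩
    · rfl
    · exact absurd h2 h3
  · intro s hs
    obtain ⟨a, b, hab, rfl⟩ := Finset.card_eq_two.1 hs.2.1
    have h := (pair_mem_interiorEdges_iff hab).1 hs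
    by_cases hl : LexLT a b
    · exact ⟨(a, b), mem_intEdges.2 ⟨hl, h⟩, rfl⟩
    · have hl' : LexLT b a := (lexLT_iff_not hab.symm).2 hl
      rw [Finset.pair_comm] at hs ⊢
      exact ⟨(b, a), mem_intEdges.2 ⟨hl', (pair_mem_interiorEdges_iff hab.symm).1 hs⟩, rfl⟩

lemma IsBdry.unique {u' : Plane} (h : IsBdry Δ v w u) (h' : IsBdry Δ v w u') : u = u' :=
  h'.2 u h.1

lemma disjoint_intEdges_bdryEdges : Disjoint (intEdges hfin) (bdryEdges hfin) := by
  refine Finset.disjoint_left.2 ?_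
  rintro ⟨a, b⟩ h h'
  obtain ⟨u, hB, -⟩ := mem_bdryEdges.1 h'
  exact (mem_intEdges.1 h).2.2 ⟨u, hB⟩

/-- The lexicographic interior edges and the boundary edges with the complex on the left together
contain every edge in exactly one orientation. -/
lemma euler_ineq (hfin : Δ.faces.Finite) (hpure : IsPure Δ)
    (hcontr : ContractibleSpace Δ.space) :
    (intEdges hfin).card + (bdryEdges hfin).card + 1 ≤
      (intVerts hfin).card + (bdryVerts hfin).card + (triangles Δ).ncard := by
  have h := euler_char_ge hfin hpure hcontr (intEdges hfin ∪ bdryEdges hfin) (by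
    rintro ⟨a, b⟩ h
    rcases Finset.mem_union.1 h with h | h
    · have := mem_intEdges.1 h
      exact ⟨this.1.ne, this.2.1⟩
    · obtain ⟨u, hB, -⟩ := mem_bdryEdges.1 h
      exact ⟨hB.1.ne₁₂, hB.1.pair_mem⟩) (by
    intro v w hne hf
    have hf' : {w, v} ∈ Δ.faces := by rwa [Finset.pair_comm]
    rw [Finset.mem_union, Finset.mem_union, mem_intEdges, mem_intEdges, mem_bdryEdges,
      mem_bdryEdges]
    by_cases hB : ∃ u, IsBdry Δ v w u
    · obtain ⟨u, hB⟩ := hB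
      have e1 : (∃ u, IsBdry Δ v w u ∧ 0 < orient v w u) ↔ 0 < orient v w u :=
        ⟨fun ⟨y, hy, hpos⟩ => by rwa [hB.unique hy], fun h => ⟨u, hB, h⟩⟩
      have e2 : (∃ u, IsBdry Δ w v u ∧ 0 < orient w v u) ↔ orient v w u < 0 := by
        refine ⟨fun ⟨y, hy, hpos⟩ => ?_, fun h => ⟨u, hB.swap_left, ?_⟩⟩
        · rw [hB.unique hy.swap_left]
          rw [orient_swap_left] at hpos
          linarith
        · rw [orient_swap_left]; linarith
      rw [e1, e2]
      have n1 : ∃ u, IsBdry Δ v w u := ⟨u, hB⟩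
      have n2 : ∃ u, IsBdry Δ w v u := ⟨u, hB.swap_left⟩
      simp only [n1, n2, not_true, and_false, false_or, not_lt]
      exact ⟨le_of_lt, fun h => lt_of_le_of_ne h hB.1.orient_ne.symm⟩
    · have hB' : ¬ ∃ u, IsBdry Δ w v u := fun ⟨u, h⟩ => hB ⟨u, h.swap_left⟩
      have e1 : ¬ ∃ u, IsBdry Δ v w u ∧ 0 < orient v w u := fun ⟨u, h, _⟩ => hB ⟨u, h⟩
      have e2 : ¬ ∃ u, IsBdry Δ w v u ∧ 0 < orient w v u := fun ⟨u, h, _⟩ => hB' ⟨u, h⟩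
      simp only [hf, hf', hB, hB', e1, e2, not_false_eq_true, and_true, or_false]
      exact lexLT_iff_not hne)
  rw [Finset.card_union_of_disjoint disjoint_intEdges_bdryEdges] at h
  have h2 : (intVerts hfin).card + (bdryVerts hfin).card = (verts hfin).card := by
    rw [add_comm]
    exact Finset.card_filter_add_card_filter_not _
  omega

section Linear

variable {P Q : Type*} [AddCommGroup P] [Module ℝ P] [AddCommGroup Q] [Module ℝ Q]

/-- Extension by zero of a family indexed by the triangles. -/
def extendTri (Δ : SimplicialComplex ℝ Plane) :
    (triangles Δ → P) →ₗ[ℝ] (Finset Plane → P) where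
  toFun p s := if h : s ∈ triangles Δ then p ⟨s, h⟩ else 0
  map_add' p q := by
    ext s
    simp only [Pi.add_apply]
    split_ifs <;> simp
  map_smul' t p := by
    ext s
    simp only [Pi.smul_apply, RingHom.id_apply]
    split_ifs <;> simp

lemma extendTri_of_mem (p : triangles Δ → P) {s : Finset Plane} (h : s ∈ triangles Δ) :
    extendTri Δ p s = p ⟨s, h⟩ := dif_pos h

lemma extendTri_of_notMem (p : triangles Δ → P) (s : Finset Plane) (h : s ∉ triangles Δ) :
    extendTri Δ p s = 0 := dif_neg h

/-- The flux as a linear map. -/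
def fluxMap (hfin : Δ.faces.Finite) (v w : Plane) : (Finset Plane → P) →ₗ[ℝ] P where
  toFun g := flux hfin g v w
  map_add' g h := by
    simp [flux, Finset.sum_add_distrib]
  map_smul' t g := by
    simp only [flux, Pi.smul_apply, RingHom.id_apply, Finset.smul_sum]
    exact Finset.sum_congr rfl fun u _ => smul_comm _ _ _

lemma exists_apex (e : bdryEdges hfin) :
    ∃ u, IsBdry Δ e.1.1 e.1.2 u ∧ 0 < orient e.1.1 e.1.2 u :=
  mem_bdryEdges.1 e.2

/-- The triangle at an oriented boundary edge. -/
def bdryTri (e : bdryEdges hfin) : triangles Δ :=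
  ⟨_, (exists_apex e).choose_spec.1.1.mem_triangles⟩

lemma bdryTri_eq (h : IsBdry Δ v w u) (he : (v, w) ∈ bdryEdges hfin) :
    bdryTri ⟨(v, w), he⟩ = ⟨{v, w, u}, h.1.mem_triangles⟩ := by
  refine Subtype.ext ?_
  have := (exists_apex ⟨(v, w), he⟩).choose_spec.1.unique h
  simp only [bdryTri]
  rw [this]

lemma fst_mem_bdryVerts (e : bdryEdges hfin) : e.1.1 ∈ bdryVerts hfin := by
  obtain ⟨u, hB, -⟩ := exists_apex e
  exact mem_bdryVerts.2 ⟨_, u, hB⟩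

/-- The linear conditions for smoothness: the differences of the polynomials across the interior
edges are given by cofactors, and all polynomials at outgoing boundary edges of a boundary vertex
agree. -/
def gluing (hfin : Δ.faces.Finite) (μ : Plane → Plane → Q →ₗ[ℝ] P) :
    ((triangles Δ → P) × (bdryVerts hfin → P) × (intEdges hfin → Q)) →ₗ[ℝ]
      (intEdges hfin → P) × (bdryEdges hfin → P) :=
  LinearMap.prod
    { toFun := fun x e => fluxMap hfin e.1.1 e.1.2 (extendTri Δ x.1) - μ e.1.1 e.1.2 (x.2.2 e)
      map_add' := fun x y => by
        ext e
        simp only [Prod.fst_add, Prod.snd_add, Pi.add_apply, map_add]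
        abel
      map_smul' := fun t x => by
        ext e
        simp only [Prod.smul_fst, Prod.smul_snd, Pi.smul_apply, map_smul, RingHom.id_apply,
          smul_sub] }
    { toFun := fun x e => x.1 (bdryTri e) - x.2.1 ⟨e.1.1, fst_mem_bdryVerts e⟩
      map_add' := fun x y => by
        ext e
        simp only [Prod.fst_add, Prod.snd_add, Pi.add_apply]
        abel
      map_smul' := fun t x => by
        ext e
        simp only [Prod.smul_fst, Prod.smul_snd, Pi.smul_apply, RingHom.id_apply, smul_sub] }

/-- The signed sum of an edge function at the interior vertices. -/
def divergence (P : Type*) [AddCommGroup P] [Module ℝ P] (hfin : Δ.faces.Finite) :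
    (intEdges hfin → P) →ₗ[ℝ] (intVerts hfin → P) where
  toFun y v := ∑ e : intEdges hfin,
    ((if e.1.1 = v then y e else 0) - (if e.1.2 = v then y e else 0))
  map_add' a b := by
    ext v
    simp only [Pi.add_apply, ← Finset.sum_add_distrib]
    refine Finset.sum_congr rfl fun e _ => ?_
    split_ifs <;> abel
  map_smul' t a := by
    ext v
    simp only [Pi.smul_apply, RingHom.id_apply, Finset.smul_sum]
    refine Finset.sum_congr rfl fun e _ => ?_
    split_ifs <;> simp

lemma divergence_apply (y : intEdges hfin → P) (v : intVerts hfin) :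
    divergence P hfin y v = ∑ e : intEdges hfin,
      ((if e.1.1 = v then y e else 0) - (if e.1.2 = v then y e else 0)) := rfl

lemma exists_isTri_of_singleton_mem (hpure : IsPure Δ) (hv : {v} ∈ Δ.faces) :
    ∃ w u, IsTri Δ v w u := by
  obtain ⟨σ, hσ, hc, hsub⟩ := hpure _ hv
  obtain ⟨w, u, -, hT⟩ := exists_isTri_of_mem hσ hc (hsub (by simp : v ∈ {v}))
  exact ⟨w, u, hT⟩

/-- An interior vertex has an edge to a vertex further right; placing `p` on it yields `p` at the
left end and `-p` at the right end, the latter dropped at the boundary. So a rightmost vertex whose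
single values are not all attained cannot exist. -/
lemma divergence_surjective (hfin : Δ.faces.Finite) (hpure : IsPure Δ) :
    Function.Surjective (divergence P hfin) := by
  rw [← LinearMap.range_eq_top, eq_top_iff]
  have key : ∀ v : intVerts hfin, ∀ p : P, Pi.single v p ∈ LinearMap.range (divergence P hfin) := by
    by_contra hcon
    push Not at hcon
    set bad : Finset (intVerts hfin) := Finset.univ.filter fun v =>
      ∃ p : P, Pi.single v p ∉ LinearMap.range (divergence P hfin) with hbad
    have hne : bad.Nonempty := by
      obtain ⟨v, p, h⟩ := hcon
      exact ⟨v, Finset.mem_filter.2 ⟨Finset.mem_univ _, p, h⟩⟩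
    obtain ⟨v, hv, hmax⟩ := bad.exists_max_image (fun v => v.1 0) hne
    obtain ⟨p, hp⟩ := (Finset.mem_filter.1 hv).2
    apply hp
    have hvi := mem_intVerts.1 v.2
    obtain ⟨w, u, hT, hlt⟩ := exists_isTri_right hfin
      (exists_isTri_of_singleton_mem hpure hvi.1) hvi.2
    have he : (v.1, w) ∈ intEdges hfin :=
      mem_intEdges.2 ⟨Or.inl hlt, hT.pair_mem, fun ⟨y, hy⟩ => hvi.2 ⟨w, y, hy⟩⟩
    have hdiv : divergence P hfin (Pi.single ⟨(v.1, w), he⟩ p) =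
        Pi.single v p - (if hw : w ∈ intVerts hfin then Pi.single ⟨w, hw⟩ p else 0) := by
      ext z
      rw [divergence_apply, Finset.sum_eq_single ⟨(v.1, w), he⟩]
      · simp only [Pi.single_eq_same, Pi.sub_apply]
        congr 1
        · by_cases hz : v = z
          · subst hz; simp
          · rw [if_neg fun h => hz (Subtype.ext h), Pi.single_eq_of_ne (Ne.symm hz)]
        · by_cases hw : w ∈ intVerts hfin
          · rw [dif_pos hw]
            by_cases hz : w = z
            · subst hz; simp
            · rw [if_neg hz, Pi.single_eq_of_ne fun h => hz (congrArg Subtype.val h).symm]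
          · rw [dif_neg hw, if_neg]
            · rfl
            · rintro rfl
              exact hw z.2
      · intro b _ hb
        rw [Pi.single_eq_of_ne hb]; simp
      · intro h; exact absurd (Finset.mem_univ _) h
    have hsplit : Pi.single v p = divergence P hfin (Pi.single ⟨(v.1, w), he⟩ p) +
        (if hw : w ∈ intVerts hfin then Pi.single ⟨w, hw⟩ p else 0) := by
      rw [hdiv]; abel
    rw [hsplit]
    refine add_mem (LinearMap.mem_range_self _ _) ?_
    by_cases hw : w ∈ intVerts hfin
    · rw [dif_pos hw]
      by_contra hnot
      have := hmax ⟨w, hw⟩ (Finset.mem_filter.2 ⟨Finset.mem_univ _, p, hnot⟩)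
      exact absurd hlt (not_lt.2 this)
    · rw [dif_neg hw]; exact zero_mem _
  intro y _
  have hy : y = ∑ v, Pi.single v (y v) := by
    ext z
    rw [Finset.sum_apply, Finset.sum_pi_single]
    simp
  rw [hy]
  exact sum_mem fun v _ => key v _

lemma sum_intEdges_eq {M : Type*} [AddCommMonoid M] (f : Plane → Plane → M) :
    ∑ e : intEdges hfin, f e.1.1 e.1.2 =
      ∑ a ∈ verts hfin, ∑ b ∈ verts hfin, if (a, b) ∈ intEdges hfin then f a b else 0 := by
  rw [Finset.sum_coe_sort (intEdges hfin) fun e : Plane × Plane => f e.1 e.2,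
    ← Finset.sum_product', ← Finset.sum_filter]
  refine Finset.sum_congr ?_ fun _ _ => rfl
  ext ⟨a, b⟩
  simp only [Finset.mem_filter, Finset.mem_product]
  exact ⟨fun h => ⟨Finset.mem_product.1 (Finset.mem_filter.1 h).1, h⟩, fun h => h.2⟩

/-- Every edge on a triangle at an interior vertex is interior, and reversing an edge changes the
sign of its flux, so this is the full sum of `sum_flux`. -/
lemma divergence_flux {g : Finset Plane → P}
    (hg : ∀ s, s ∉ triangles Δ → g s = 0) (v : intVerts hfin) :
    divergence P hfin (fun e => flux hfin g e.1.1 e.1.2) v = 0 := by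
  have hvi := mem_intVerts.1 v.2
  have hvV : v.1 ∈ verts hfin := mem_verts.2 hvi.1
  have h1 : ∑ e : intEdges hfin, (if e.1.1 = v.1 then flux hfin g e.1.1 e.1.2 else 0) =
      ∑ w ∈ verts hfin, if (v.1, w) ∈ intEdges hfin then flux hfin g v w else 0 := by
    rw [sum_intEdges_eq fun a b => if a = v.1 then flux hfin g a b else 0,
      Finset.sum_eq_single_of_mem v.1 hvV fun a _ ha => Finset.sum_eq_zero fun b _ => by simp [ha]]
    simp
  have h2 : ∑ e : intEdges hfin, (if e.1.2 = v.1 then flux hfin g e.1.1 e.1.2 else 0) =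
      ∑ w ∈ verts hfin, if (w, v.1) ∈ intEdges hfin then flux hfin g w v else 0 := by
    rw [sum_intEdges_eq fun a b => if b = v.1 then flux hfin g a b else 0, Finset.sum_comm,
      Finset.sum_eq_single_of_mem v.1 hvV fun a _ ha => Finset.sum_eq_zero fun b _ => by simp [ha]]
    simp
  rw [divergence_apply, Finset.sum_sub_distrib, h1, h2]
  rw [← Finset.sum_sub_distrib]
  refine Eq.trans ?_ (sum_flux hfin g v.1)
  refine Finset.sum_congr rfl fun w _ => ?_
  rw [flux_swap hfin g v.1 w]
  by_cases hT : ∃ u, IsTri Δ v w u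
  · obtain ⟨u, hT⟩ := hT
    have hB : ¬ ∃ u, IsBdry Δ v w u := fun ⟨u, hB⟩ => hvi.2 ⟨w, u, hB⟩
    have hB' : ¬ ∃ u, IsBdry Δ w v u := fun ⟨u, hB⟩ => hvi.2 ⟨w, u, hB.swap_left⟩
    have hor := lexLT_iff_not hT.ne₁₂
    have m1 : (v.1, w) ∈ intEdges hfin ↔ LexLT v w := by
      rw [mem_intEdges]; exact ⟨fun h => h.1, fun h => ⟨h, hT.pair_mem, hB⟩⟩
    have m2 : (w, v.1) ∈ intEdges hfin ↔ LexLT w v := by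
      rw [mem_intEdges]; exact ⟨fun h => h.1, fun h => ⟨h, hT.swap_left.pair_mem, hB'⟩⟩
    by_cases hl : LexLT v w
    · rw [if_pos (m1.2 hl), if_neg fun h => hor.1 hl (m2.1 h), sub_zero]
    · rw [if_neg fun h => hl (m1.1 h), if_pos (m2.2 (by_contra fun h => hl (hor.2 h))), zero_sub,
        neg_neg]
  · push Not at hT
    rw [flux_eq_zero hfin hg hT]
    simp

variable [FiniteDimensional ℝ P] [FiniteDimensional ℝ Q]

/-- The lower bound for the dimension of the solution space of the gluing conditions. -/
theorem finrank_ker_gluing_ge (hfin : Δ.faces.Finite) (hpure : IsPure Δ)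
    (hcontr : ContractibleSpace Δ.space) (μ : Plane → Plane → Q →ₗ[ℝ] P)
    (J : Plane → Submodule ℝ P)
    (hJ : ∀ v w, v ≠ w → {v, w} ∈ Δ.faces →
      LinearMap.range (μ v w) ≤ J v ∧ LinearMap.range (μ v w) ≤ J w) :
    (Module.finrank ℝ P : ℤ) + (intEdges hfin).card * (Module.finrank ℝ Q : ℤ)
      - ∑ v ∈ intVerts hfin, (Module.finrank ℝ (J v) : ℤ) ≤
      Module.finrank ℝ (LinearMap.ker (gluing hfin μ)) := by
  have : Fintype (triangles Δ) := (finite_triangles hfin).fintype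
  let π : (intVerts hfin → P) →ₗ[ℝ] (∀ v : intVerts hfin, P ⧸ J v) :=
    LinearMap.pi fun v => (J v).mkQ ∘ₗ LinearMap.proj v
  have hπ : Function.Surjective π := fun z => by
    choose y hy using fun v : intVerts hfin => (J (v : Plane)).mkQ_surjective (z v)
    exact ⟨y, funext hy⟩
  let Ψ := (π ∘ₗ divergence P hfin) ∘ₗ
    LinearMap.fst ℝ (intEdges hfin → P) (bdryEdges hfin → P)
  have hΨs : Function.Surjective Ψ := (hπ.comp (divergence_surjective hfin hpure)).comp Prod.fst_surjective
  -- The fluxes have divergence zero, and the cofactor terms at `v` lie in `J v`.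
  have hrange : LinearMap.range (gluing hfin μ) ≤ LinearMap.ker Ψ := by
    rintro _ ⟨⟨p, q, c⟩, rfl⟩
    refine LinearMap.mem_ker.2 (funext fun v => ?_)
    have e1 : (gluing hfin μ (p, q, c)).1 =
        (fun e : intEdges hfin => flux hfin (extendTri Δ p) e.1.1 e.1.2) -
          fun e : intEdges hfin => (μ e.1.1 e.1.2 (c e) : P) := rfl
    change (J v).mkQ (divergence P hfin (gluing hfin μ (p, q, c)).1 v) = 0
    rw [e1, map_sub, Pi.sub_apply, divergence_flux (extendTri_of_notMem p), zero_sub,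
      Submodule.mkQ_apply, Submodule.Quotient.mk_eq_zero, neg_mem_iff, divergence_apply]
    refine sum_mem fun e _ => ?_
    have hmem := mem_intEdges.1 e.2
    have hJe := hJ _ _ hmem.1.ne hmem.2.1
    refine sub_mem ?_ ?_
    · split_ifs with h
      · rw [← h]; exact hJe.1 (LinearMap.mem_range_self _ _)
      · exact zero_mem _
    · split_ifs with h
      · rw [← h]; exact hJe.2 (LinearMap.mem_range_self _ _)
      · exact zero_mem _
  have r1 := (gluing hfin μ).finrank_range_add_finrank_ker
  have r2 := Submodule.finrank_mono hrange
  have r3 := Ψ.finrank_range_add_finrank_ker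
  rw [LinearMap.range_eq_top.2 hΨs, finrank_top, Module.finrank_prod,
    Module.finrank_pi_fintype ℝ, Module.finrank_pi_fintype ℝ, Module.finrank_pi_fintype ℝ,
    Finset.sum_const, Finset.sum_const, Finset.card_univ, Finset.card_univ, Fintype.card_coe,
    Fintype.card_coe] at r3
  rw [Module.finrank_prod, Module.finrank_prod, Module.finrank_pi_fintype ℝ,
    Module.finrank_pi_fintype ℝ, Module.finrank_pi_fintype ℝ, Finset.sum_const, Finset.sum_const,
    Finset.sum_const, Finset.card_univ, Finset.card_univ, Finset.card_univ, Fintype.card_coe,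
    Fintype.card_coe] at r1
  have hquot : ∀ v : Plane, (Module.finrank ℝ (P ⧸ J v) : ℤ) =
      Module.finrank ℝ P - Module.finrank ℝ (J v) := fun v => by
    have := (J v).finrank_quotient_add_finrank
    omega
  have r5 : ((∑ v : intVerts hfin, Module.finrank ℝ (P ⧸ J (v : Plane)) : ℕ) : ℤ) =
      (intVerts hfin).card * (Module.finrank ℝ P : ℤ) -
        ∑ v ∈ intVerts hfin, (Module.finrank ℝ (J v) : ℤ) := by
    rw [Finset.sum_coe_sort (intVerts hfin) fun v => Module.finrank ℝ (P ⧸ J v)]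
    push_cast
    rw [Finset.sum_congr rfl fun v _ => hquot v, Finset.sum_sub_distrib, Finset.sum_const,
      nsmul_eq_mul]
  have hE := euler_ineq hfin hpure hcontr
  have hcard : (triangles Δ).ncard = Fintype.card (triangles Δ) := by
    rw [← Nat.card_coe_set_eq, Nat.card_eq_fintype_card]
  rw [hcard] at hE
  -- All cell counts with coefficient `dim P` combine to the Euler characteristic.
  have hE' := Nat.mul_le_mul_right (Module.finrank ℝ P) hE
  simp only [smul_eq_mul] at r1 r3
  zify at r1 r2 r3 hE'
  rw [← Nat.cast_sum, r5] at r3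
  nlinarith

end Linear

end GluingConditions

/-! ### Solutions of the gluing conditions as splines. -/

section Splines

open MvPolynomial

variable {Δ : SimplicialComplex ℝ Plane} {v w u : Plane} {hfin : Δ.faces.Finite}

/-- For `k < r` the truncated difference leaves only the zero cofactor, so the degree bound
persists. -/
lemma line_pow_mul_mem (v d : Plane) (r k : ℕ) {q : Poly} (hq : q ∈ polyLT (k - r)) :
    line v d ^ (r + 1) * q ∈ polyLT (k + 1) := by
  by_cases hkr : r ≤ k
  · exact polyLT_mono (by omega) (line_pow_mul_mem_polyLT v d (r + 1) hq)
  · have : q = 0 := by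
      rw [show k - r = 0 by omega] at hq
      rw [← support_eq_empty, Finset.eq_empty_iff_forall_notMem]
      intro n hn
      exact absurd (hq hn) (Nat.not_lt_zero _)
    rw [this, mul_zero]
    exact zero_mem _

/-- Multiplication of a cofactor by a power of the equation of the line through `v` and `w`. -/
def cofactorMap (r k : ℕ) (v w : Plane) : polyLT (k - r) →ₗ[ℝ] polyLT (k + 1) :=
  ((LinearMap.mulLeft ℝ (line v (w - v) ^ (r + 1))).domRestrict (polyLT (k - r))).codRestrict
    (polyLT (k + 1)) fun q => line_pow_mul_mem v (w - v) r k q.2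

lemma coe_cofactorMap (r k : ℕ) (v w : Plane) (q : polyLT (k - r)) :
    (cofactorMap r k v w q : Poly) = line v (w - v) ^ (r + 1) * q := rfl

/-- The vertices adjacent to `v`. -/
def neighbours (hfin : Δ.faces.Finite) (v : Plane) : Finset Plane :=
  (verts hfin).filter fun w => w ≠ v ∧ {v, w} ∈ Δ.faces

lemma mem_neighbours : w ∈ neighbours hfin v ↔ w ≠ v ∧ {v, w} ∈ Δ.faces := by
  rw [neighbours, Finset.mem_filter, and_iff_right_iff_imp]
  exact fun h => mem_verts_of_mem h.2 (by simp)

/-- The polynomials generated by the edges at `v`. -/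
def vertexSpace (hfin : Δ.faces.Finite) (r k : ℕ) (v : Plane) : Submodule ℝ (polyLT (k + 1)) :=
  ((neighbours hfin v).sup fun w => lineMul v (w - v) (r + 1) (k - r)).comap
    (polyLT (k + 1)).subtype

lemma range_cofactorMap_le (r k : ℕ) (hne : v ≠ w) (hf : {v, w} ∈ Δ.faces) :
    LinearMap.range (cofactorMap r k v w) ≤ vertexSpace hfin r k v ∧
      LinearMap.range (cofactorMap r k v w) ≤ vertexSpace hfin r k w := by
  constructor
  · rintro _ ⟨q, rfl⟩
    have hw : w ∈ neighbours hfin v := mem_neighbours.2 ⟨hne.symm, hf⟩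
    exact Finset.le_sup (f := fun w => lineMul v (w - v) (r + 1) (k - r)) hw ⟨q, q.2, rfl⟩
  · rintro _ ⟨q, rfl⟩
    have hv : v ∈ neighbours hfin w := mem_neighbours.2 ⟨hne, by rwa [Finset.pair_comm]⟩
    refine Finset.le_sup (f := fun v => lineMul w (v - w) (r + 1) (k - r)) hv
      ⟨((-1 : ℝ) ^ (r + 1)) • q, Submodule.smul_mem _ _ q.2, ?_⟩
    simp only [LinearMap.mulLeft_apply, Submodule.subtype_apply, coe_cofactorMap]
    rw [line_swap v w, smul_eq_C_mul, map_pow, map_neg, map_one, ← mul_assoc, ← mul_pow]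
    simp

/-- The slopes of the edges at `v`, as a finite set. -/
def slopes (hfin : Δ.faces.Finite) (v : Plane) : Finset (Submodule ℝ Plane) :=
  (neighbours hfin v).image fun w => Submodule.span ℝ {w - v}

lemma card_slopes (hfin : Δ.faces.Finite) (v : Plane) :
    (slopes hfin v).card = slopeCount Δ v := by
  unfold slopeCount
  rw [← Set.ncard_coe_finset]
  congr 1
  ext L
  simp only [slopes, Finset.coe_image, Set.mem_image, Finset.mem_coe, mem_neighbours, edgeSlopes,
    Set.mem_ofPred_eq]
  constructor
  · rintro ⟨w, ⟨h1, h2⟩, rfl⟩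
    exact ⟨w, h1, h2, rfl⟩
  · rintro ⟨w, h1, h2, rfl⟩
    exact ⟨w, ⟨h1, h2⟩, rfl⟩

lemma two_le_slopeCount (hfin : Δ.faces.Finite) (hT : IsTri Δ v w u) : 2 ≤ slopeCount Δ v := by
  rw [← card_slopes hfin]
  have hw : w ∈ neighbours hfin v := mem_neighbours.2 ⟨hT.ne₁₂.symm, hT.pair_mem⟩
  have hu : u ∈ neighbours hfin v := mem_neighbours.2 ⟨hT.ne₁₃.symm, hT.swap.pair_mem⟩
  refine Finset.one_lt_card.2 ⟨_, Finset.mem_image_of_mem _ hw, _, Finset.mem_image_of_mem _ hu,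
    fun h => ?_⟩
  have hmem : u - v ∈ Submodule.span ℝ {w - v} := by
    rw [h]; exact Submodule.mem_span_singleton_self _
  obtain ⟨a, ha⟩ := Submodule.mem_span_singleton.1 hmem
  apply hT.orient_ne
  rw [orient, ← ha, det2_smul_right, det2_self, mul_zero]

/-- One direction per slope lets collinear edges share their multiples, so slopes rather than edges
are counted. -/
lemma exists_direction (hfin : Δ.faces.Finite) (v : Plane) :
    ∃ d : Submodule ℝ Plane → Plane, ∀ w ∈ neighbours hfin v,
      ∃ t : ℝ, w - v = t • d (Submodule.span ℝ {w - v}) := by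
  have h : ∀ L : Submodule ℝ Plane, ∃ d : Plane, (∃ d' : Plane, L = Submodule.span ℝ {d'}) →
      L = Submodule.span ℝ {d} := fun L => by
    by_cases h : ∃ d' : Plane, L = Submodule.span ℝ {d'}
    · obtain ⟨d, hd⟩ := h
      exact ⟨d, fun _ => hd⟩
    · exact ⟨0, fun h' => absurd h' h⟩
  choose d hd using h
  refine ⟨d, fun w _ => ?_⟩
  have h1 := hd (Submodule.span ℝ {w - v}) ⟨_, rfl⟩
  have h2 : w - v ∈ Submodule.span ℝ {d (Submodule.span ℝ {w - v})} := by
    rw [← h1]; exact Submodule.mem_span_singleton_self _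
  obtain ⟨t, ht⟩ := Submodule.mem_span_singleton.1 h2
  exact ⟨t, ht.symm⟩

lemma finrank_vertexSpace_le (hfin : Δ.faces.Finite) (hpure : IsPure Δ) (r k : ℕ)
    (hv : {v} ∈ Δ.faces) :
    (Module.finrank ℝ (vertexSpace hfin r k v) : ℤ) ≤
      (slopeCount Δ v : ℤ) * ((k + 2 - (r + 1)).choose 2 : ℤ)
        - bMult (slopeCount Δ v) r * ((k + 2 - Omega (slopeCount Δ v) r).choose 2 : ℤ)
        - aMult (slopeCount Δ v) r
          * ((k + 2 - (Omega (slopeCount Δ v) r + 1)).choose 2 : ℤ) := by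
  obtain ⟨w, u, hT⟩ := exists_isTri_of_singleton_mem hpure hv
  obtain ⟨d, hd⟩ := exists_direction hfin v
  set A : Submodule ℝ Poly := (slopes hfin v).sup fun L => lineMul v (d L) (r + 1) (k - r) with hA
  have hle : ((neighbours hfin v).sup fun w => lineMul v (w - v) (r + 1) (k - r)) ≤ A := by
    refine Finset.sup_le fun w hw => ?_
    obtain ⟨t, ht⟩ := hd w hw
    have h1 : lineMul v (w - v) (r + 1) (k - r) ≤
        lineMul v (d (Submodule.span ℝ {w - v})) (r + 1) (k - r) := by
      conv_lhs => rw [ht]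
      exact lineMul_smul_le _ _ _ _ _
    exact h1.trans (Finset.le_sup (f := fun L => lineMul v (d L) (r + 1) (k - r))
      (Finset.mem_image_of_mem _ hw))
  have hfinrank : Module.finrank ℝ (vertexSpace hfin r k v) ≤ Module.finrank ℝ A := by
    let ι : vertexSpace hfin r k v →ₗ[ℝ] A :=
      ((polyLT (k + 1)).subtype ∘ₗ (vertexSpace hfin r k v).subtype).codRestrict A
        fun x => hle x.2
    refine LinearMap.finrank_le_finrank_of_injective (f := ι) fun x y hxy => ?_
    exact Subtype.ext (Subtype.ext (congrArg (fun a : A => (a : Poly)) hxy))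
  refine le_vertex_bound (two_le_slopeCount hfin hT) ?_ fun c hc => ?_
  · rw [← card_slopes hfin]
    exact hfinrank.trans (finrank_sup_lineMul_le _ _ _ _ _)
  · rw [← card_slopes hfin]
    exact (Nat.add_le_add_right hfinrank _).trans (finrank_sup_lineMul_add_le _ _ _ _ hc)

section Gluing

variable {r k : ℕ} {p : triangles Δ → polyLT (k + 1)} {q : bdryVerts hfin → polyLT (k + 1)}
  {c : intEdges hfin → polyLT (k - r)}

lemma jetEq_of_mem_intEdges (h : gluing hfin (cofactorMap r k) (p, q, c) = 0) {u' x : Plane}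
    (hT : IsTri Δ v w u) (hT' : IsTri Δ v w u') (hne : u ≠ u') (he : (v, w) ∈ intEdges hfin)
    (hx : det2 (w - v) (x - v) = 0) :
    JetEq r x (extendTri Δ p {v, w, u} : polyLT (k + 1))
      (extendTri Δ p {v, w, u'} : polyLT (k + 1)) := by
  have h1 : flux hfin (extendTri Δ p) v w - cofactorMap r k v w (c ⟨(v, w), he⟩) = 0 :=
    congrFun (congrArg Prod.fst h) ⟨(v, w), he⟩
  rw [flux_of_two hfin (extendTri_of_notMem p) hT hT' hne, sub_eq_zero] at h1
  set σ := Real.sign (orient v w u) with hσ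
  have hσ2 : σ * σ = 1 := by
    rcases Real.sign_apply_eq_of_ne_zero _ hT.orient_ne with h | h <;> rw [hσ, h] <;> norm_num
  have h2 : (extendTri Δ p {v, w, u} : polyLT (k + 1)) =
      extendTri Δ p {v, w, u'} + σ • cofactorMap r k v w (c ⟨(v, w), he⟩) := by
    rw [← h1, smul_smul, hσ2, one_smul]; abel
  refine jetEq_of_line (c := σ • (c ⟨(v, w), he⟩ : Poly)) hx ?_
  rw [h2, Submodule.coe_add, Submodule.coe_smul, coe_cofactorMap, mul_smul_comm]

lemma jetEq_of_edge (h : gluing hfin (cofactorMap r k) (p, q, c) = 0) {u' x : Plane}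
    (hT : IsTri Δ v w u) (hT' : IsTri Δ v w u') (hne : u ≠ u')
    (hx : det2 (w - v) (x - v) = 0) :
    JetEq r x (extendTri Δ p {v, w, u} : polyLT (k + 1))
      (extendTri Δ p {v, w, u'} : polyLT (k + 1)) := by
  have hB : ¬ ∃ y, IsBdry Δ v w y := by
    rintro ⟨y, hy⟩
    exact hne ((hy.2 u hT).trans (hy.2 u' hT').symm)
  by_cases hl : LexLT v w
  · exact jetEq_of_mem_intEdges h hT hT' hne (mem_intEdges.2 ⟨hl, hT.pair_mem, hB⟩) hx
  · have hl' : LexLT w v := (lexLT_iff_not hT.ne₁₂.symm).2 hl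
    have := jetEq_of_mem_intEdges h hT.swap_left hT'.swap_left hne (x := x)
      (mem_intEdges.2 ⟨hl', hT.swap_left.pair_mem, fun ⟨y, hy⟩ => hB ⟨y, hy.swap_left⟩⟩) (by
        have : x - w = (x - v) + (-1 : ℝ) • (w - v) := by module
        have h3 : v - w = (-1 : ℝ) • (w - v) := by module
        rw [this, h3, det2_smul_left, det2_add_right, hx, det2_smul_right, det2_self]
        ring)
    rwa [Finset.insert_comm w v, Finset.insert_comm w v] at this

lemma apply_bdryTri_eq (h : gluing hfin (cofactorMap r k) (p, q, c) = 0) (hB : IsBdry Δ v w u)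
    (hpos : 0 < orient v w u) (hv : v ∈ bdryVerts hfin) :
    p ⟨{v, w, u}, hB.1.mem_triangles⟩ = q ⟨v, hv⟩ := by
  have he : (v, w) ∈ bdryEdges hfin := mem_bdryEdges.2 ⟨u, hB, hpos⟩
  have h1 : p (bdryTri ⟨(v, w), he⟩) - q ⟨v, hv⟩ = 0 :=
    congrFun (congrArg Prod.snd h) ⟨(v, w), he⟩
  rw [bdryTri_eq hB he] at h1
  exact sub_eq_zero.1 h1

/-- Jets at `v` agree across every shared edge through `v`, so a property of the jet at `v`
propagates around a fan. -/
lemma isFan_jetEq (h : gluing hfin (cofactorMap r k) (p, q, c) = 0) (v : Plane)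
    (R : Poly → Prop) (hR : ∀ a b : Poly, JetEq r v a b → R a → R b) :
    IsFan Δ v {s | s ∈ triangles Δ ∧ v ∈ s ∧ R (extendTri Δ p s : polyLT (k + 1))} where
  subset := fun s hs => ⟨hs.1, hs.2.1⟩
  closed := by
    intro w u u' hT hT' hs
    by_cases hne : u = u'
    · subst hne; exact hs
    · exact ⟨hT'.mem_triangles, by simp, hR _ _
        (jetEq_of_edge h hT hT' hne (by rw [sub_self, det2_zero_right])) hs.2.2⟩

/-- At an interior vertex the triangles with the jet of `s` form a fan, hence the whole star. At a
boundary vertex the triangles whose jet differs from that of `q` would form a fan, which would have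
an outgoing boundary edge, where equality with `q` is imposed. -/
lemma jetEq_of_vertex (h : gluing hfin (cofactorMap r k) (p, q, c) = 0) {s t : Finset Plane}
    (hs : s ∈ triangles Δ) (ht : t ∈ triangles Δ) (hvs : v ∈ s) (hvt : v ∈ t) :
    JetEq r v (extendTri Δ p s : polyLT (k + 1)) (extendTri Δ p t : polyLT (k + 1)) := by
  by_cases hv : ∃ w u, IsBdry Δ v w u
  · have hvb : v ∈ bdryVerts hfin := mem_bdryVerts.2 hv
    have key : ∀ s, s ∈ triangles Δ → v ∈ s →
        JetEq r v (extendTri Δ p s : polyLT (k + 1)) (q ⟨v, hvb⟩) := by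
      intro s hs hvs
      by_contra hcon
      obtain ⟨w, u, hB, hpos, -, -, hn⟩ := (isFan_jetEq h v
        (fun a => ¬ JetEq r v a (q ⟨v, hvb⟩)) fun a b hab ha hb => ha (hab.trans hb)).exists_isBdry
        hfin ⟨s, hs, hvs, hcon⟩ hv
      apply hn
      rw [extendTri_of_mem p hB.1.mem_triangles, apply_bdryTri_eq h hB hpos hvb]
      exact JetEq.refl _ _ _
    exact (key s hs hvs).trans (key t ht hvt).symm
  · obtain ⟨w, u, rfl, hT⟩ := exists_isTri_of_mem ht.1 ht.2 hvt
    exact ((isFan_jetEq h v (fun a => JetEq r v (extendTri Δ p s : polyLT (k + 1)) a)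
      fun a b hab ha => ha.trans hab).mem_of_interior hfin ⟨s, hs, hvs, JetEq.refl _ _ _⟩ hv hT).2.2

lemma jetEq_of_mem_inter (h : gluing hfin (cofactorMap r k) (p, q, c) = 0) (s t : triangles Δ)
    {x : Plane} (hxs : x ∈ convexHull ℝ ((s : Finset Plane) : Set Plane))
    (hxt : x ∈ convexHull ℝ ((t : Finset Plane) : Set Plane)) : JetEq r x (p s) (p t) := by
  obtain ⟨s, hs⟩ := s
  obtain ⟨t, ht⟩ := t
  rw [← extendTri_of_mem p hs, ← extendTri_of_mem p ht]
  simp only at hxs hxt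
  have hx := mem_convexHull_inter hs.1 ht.1 hxs hxt
  obtain ⟨v, hv⟩ : (s ∩ t).Nonempty := by
    rw [← Finset.coe_nonempty, ← convexHull_nonempty_iff (𝕜 := ℝ)]
    exact ⟨x, hx⟩
  obtain ⟨hvs, hvt⟩ := Finset.mem_inter.1 hv
  by_cases h1 : s ∩ t = {v}
  · rw [h1, Finset.coe_singleton, convexHull_singleton, Set.mem_singleton_iff] at hx
    subst hx
    exact jetEq_of_vertex h hs ht hvs hvt
  · obtain ⟨w, hw, hwv⟩ : ∃ w ∈ s ∩ t, w ≠ v := by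
      by_contra hcon
      push Not at hcon
      exact h1 (Finset.eq_singleton_iff_unique_mem.2 ⟨hv, hcon⟩)
    obtain ⟨hws, hwt⟩ := Finset.mem_inter.1 hw
    obtain ⟨u, rfl, hT⟩ := exists_isTri_of_mem_of_mem hs.1 hs.2 hvs hws hwv.symm
    obtain ⟨u', rfl, hT'⟩ := exists_isTri_of_mem_of_mem ht.1 ht.2 hvt hwt hwv.symm
    by_cases hne : u = u'
    · subst hne; exact JetEq.refl _ _ _
    · refine jetEq_of_edge h hT hT' hne (det2_eq_zero_of_mem_convexHull_pair
        (convexHull_mono ?_ hx))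
      intro y hy
      have := hT.ne₂₃
      have := hT.ne₁₃
      simp only [Finset.coe_inter, Finset.coe_insert, Finset.coe_singleton, Set.mem_inter_iff,
        Set.mem_insert_iff, Set.mem_singleton_iff] at hy ⊢
      grind

end Gluing

/-- The piecewise polynomial function given by polynomials on the triangles. -/
def evalMap (τ : Δ.space → triangles Δ) (k : ℕ) :
    (triangles Δ → polyLT (k + 1)) →ₗ[ℝ] (Δ.space → ℝ) where
  toFun p x := fn (p (τ x)) x
  map_add' p q := by ext x; simp [fn]
  map_smul' t p := by ext x; simp [fn]

lemma splineSpace_le_range (τ : Δ.space → triangles Δ)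
    (hτ : ∀ x, (x : Plane) ∈ convexHull ℝ ((τ x : Finset Plane) : Set Plane)) (r k : ℕ) :
    splineSpace Δ r k ≤ LinearMap.range (evalMap τ k) := by
  rintro f ⟨-, hf⟩
  choose P hP hfP using fun s : triangles Δ => hf s s.2.1
  refine ⟨fun s => ⟨P s, totalDegree_le_iff.1 (hP s)⟩, ?_⟩
  ext x
  exact (hfP (τ x) x (hτ x)).symm

lemma evalMap_mem_splineSpace (hpure : IsPure Δ) (τ : Δ.space → triangles Δ)
    (hτ : ∀ x, (x : Plane) ∈ convexHull ℝ ((τ x : Finset Plane) : Set Plane)) {r k : ℕ}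
    {p : triangles Δ → polyLT (k + 1)} {q : bdryVerts hfin → polyLT (k + 1)}
    {c : intEdges hfin → polyLT (k - r)} (h : gluing hfin (cofactorMap r k) (p, q, c) = 0) :
    evalMap τ k p ∈ splineSpace Δ r k := by
  constructor
  · obtain ⟨F, hF, hFp⟩ := exists_contDiffOn_glue hfin hpure r (fun s => (p s : Poly))
      fun s t x hxs hxt => jetEq_of_mem_inter h s t hxs hxt
    exact ⟨F, hF, fun x => (hFp (τ x) x (hτ x)).symm⟩
  · intro s hs
    obtain ⟨σ, hσ, hc, hsub⟩ := hpure s hs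
    refine ⟨p ⟨σ, hσ, hc⟩, totalDegree_le_iff.2 (p ⟨σ, hσ, hc⟩).2, fun x hx => ?_⟩
    exact (jetEq_of_mem_inter h (τ x) ⟨σ, hσ, hc⟩ (hτ x)
      (convexHull_mono (by exact_mod_cast hsub) hx)).fn_eq

/-- The auxiliary unknowns are determined by `p`: every boundary vertex has an outgoing boundary
edge, and the cofactors are recovered by cancelling a nonzero power of a line. -/
lemma eq_zero_of_evalMap_eq_zero (τ : Δ.space → triangles Δ)
    (hτ : ∀ x, (x : Plane) ∈ convexHull ℝ ((τ x : Finset Plane) : Set Plane)) {r k : ℕ}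
    {p : triangles Δ → polyLT (k + 1)} {q : bdryVerts hfin → polyLT (k + 1)}
    {c : intEdges hfin → polyLT (k - r)} (h : gluing hfin (cofactorMap r k) (p, q, c) = 0)
    (h0 : evalMap τ k p = 0) : p = 0 ∧ q = 0 ∧ c = 0 := by
  have hp : p = 0 := by
    ext1 s
    refine Subtype.ext ?_
    obtain ⟨s, hs⟩ := s
    obtain ⟨v, w, u, -, -, -, rfl⟩ := Finset.card_eq_three.1 hs.2
    refine eq_zero_of_fn_eq_zero (isTri_of_mem_triangles hs).orient_ne fun x hx => ?_
    have hxs : x ∈ Δ.space := Δ.convexHull_subset_space hs.1 hx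
    have h1 := congrFun h0 ⟨x, hxs⟩
    rw [← (jetEq_of_mem_inter h (τ ⟨x, hxs⟩) ⟨_, hs⟩ (hτ ⟨x, hxs⟩) hx).fn_eq]
    exact h1
  refine ⟨hp, ?_, ?_⟩
  · ext1 v
    obtain ⟨v, hv⟩ := v
    have hvB := mem_bdryVerts.1 hv
    obtain ⟨w, u, hB, hpos, -⟩ := (isFan_star v).exists_isBdry hfin (by
      obtain ⟨w, u, hB⟩ := hvB
      exact ⟨{v, w, u}, hB.1.mem_triangles, by simp⟩) hvB
    rw [← apply_bdryTri_eq h hB hpos hv, hp]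
    rfl
  · ext1 e
    have h1 : flux hfin (extendTri Δ p) e.1.1 e.1.2 - cofactorMap r k e.1.1 e.1.2 (c e) = 0 :=
      congrFun (congrArg Prod.fst h) e
    have h2 : flux hfin (extendTri Δ p) e.1.1 e.1.2 = 0 := by
      rw [hp, map_zero]
      exact (fluxMap hfin e.1.1 e.1.2).map_zero
    rw [h2, zero_sub, neg_eq_zero] at h1
    have h3 := congrArg Subtype.val h1
    rw [coe_cofactorMap] at h3
    have hl : line e.1.1 (e.1.2 - e.1.1) ≠ 0 :=
      line_ne_zero (sub_ne_zero.2 (mem_intEdges.1 e.2).1.ne.symm)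
    exact Subtype.ext ((mul_eq_zero.1 h3).resolve_left (pow_ne_zero _ hl))

lemma finrank_cofactor (r k : ℕ) :
    Module.finrank ℝ (polyLT (k - r)) = (k + 2 - (r + 1)).choose 2 := by
  rw [finrank_polyLT]
  by_cases hkr : r ≤ k
  · rw [show k + 2 - (r + 1) = k - r + 1 by omega]
  · rw [Nat.choose_eq_zero_of_lt (by omega), Nat.choose_eq_zero_of_lt (by omega)]

end Splines

end Spline

end

/-! ### The lower bound for the dimension of the spline space. -/

theorem mainTheorem3 (Δ : Geometry.SimplicialComplex ℝ Spline.Plane)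
    (hfin : Δ.faces.Finite) (hpure : Spline.IsPure Δ)
    (hdisk : Nonempty (ContinuousMap.HomotopyEquiv Δ.space
      (Metric.closedBall (0 : Spline.Plane) 1)))
    (r k : ℕ) :
    FiniteDimensional ℝ (Spline.splineSpace Δ r k) ∧
    ((k + 2).choose 2 : ℤ)
      + ((Spline.interiorEdges Δ).ncard : ℤ) * ((k + 2 - (r + 1)).choose 2 : ℤ)
      - ∑ᶠ v ∈ Spline.interiorVertices Δ,
          ((Spline.slopeCount Δ v : ℤ) * ((k + 2 - (r + 1)).choose 2 : ℤ)
            - Spline.bMult (Spline.slopeCount Δ v) r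
                * ((k + 2 - Spline.Omega (Spline.slopeCount Δ v) r).choose 2 : ℤ)
            - Spline.aMult (Spline.slopeCount Δ v) r
                * ((k + 2 - (Spline.Omega (Spline.slopeCount Δ v) r + 1)).choose 2 : ℤ))
      ≤ (Module.finrank ℝ (Spline.splineSpace Δ r k) : ℤ) := by
  obtain ⟨e⟩ := hdisk
  have hball : ContractibleSpace (Metric.closedBall (0 : Spline.Plane) 1) :=
    Metric.contractibleSpace_closedBall zero_le_one
  have hcontr : ContractibleSpace Δ.space := e.contractibleSpace
  choose τ hτ using Spline.exists_triangle_of_mem_space hpure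
  have hfinT : Finite (Spline.triangles Δ) := Spline.finite_triangles hfin
  have hfd : FiniteDimensional ℝ (Spline.splineSpace Δ r k) :=
    Submodule.finiteDimensional_of_le (Spline.splineSpace_le_range τ hτ r k)
  refine ⟨hfd, ?_⟩
  have hker := Spline.finrank_ker_gluing_ge hfin hpure hcontr (Spline.cofactorMap r k)
    (Spline.vertexSpace hfin r k) fun v w hne hf => Spline.range_cofactorMap_le r k hne hf
  rw [Spline.finrank_polyLT, Spline.finrank_cofactor, Spline.card_intEdges] at hker
  -- Only injectivity is needed: requiring equal polynomials, not just equal jets, at boundary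
  -- vertices may exclude some splines.
  let T : LinearMap.ker (Spline.gluing hfin (Spline.cofactorMap r k)) →ₗ[ℝ]
      Spline.splineSpace Δ r k :=
    (Spline.evalMap τ k ∘ₗ LinearMap.fst ℝ _ _ ∘ₗ Submodule.subtype _).codRestrict _ fun x =>
      Spline.evalMap_mem_splineSpace hpure τ hτ (LinearMap.mem_ker.1 x.2)
  have hT : Function.Injective T := by
    rw [injective_iff_map_eq_zero]
    rintro ⟨⟨p, q, c⟩, hx⟩ h0
    obtain ⟨rfl, rfl, rfl⟩ := Spline.eq_zero_of_evalMap_eq_zero τ hτ (LinearMap.mem_ker.1 hx)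
      (congrArg Subtype.val h0)
    rfl
  have hle := LinearMap.finrank_le_finrank_of_injective hT
  rw [← Spline.coe_intVerts (hfin := hfin), finsum_mem_coe_finset]
  have hsum := Finset.sum_le_sum fun v (hv : v ∈ Spline.intVerts hfin) =>
    Spline.finrank_vertexSpace_le hfin hpure r k (Spline.mem_intVerts.1 hv).1
  have hle' : (Module.finrank ℝ
      (LinearMap.ker (Spline.gluing hfin (Spline.cofactorMap r k))) : ℤ) ≤
      Module.finrank ℝ (Spline.splineSpace Δ r k) := by exact_mod_cast hle
  linarith
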